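/- Let $M=S^3\times\mathbb R^2$, where $S^3=SU(2)$ and $\mathbb R^2$ has coordinates $(r,u)$. Let $\sigma_1,\sigma_2,\sigma_3$ be the left-invariant 1-forms on $SU(2)$ with $d\sigma_1=\sigma_2\wedge\sigma_3$, $d\sigma_2=\sigma_3\wedge\sigma_1$, $d\sigma_3=\sigma_1\wedge\sigma_2$, and let $E^1,E^2,E^3,\partial_r,\partial_u$ be the frame dual to $\sigma_1,\sigma_2,\sigma_3,dr,du$. All tensor fields below are smooth and complex-valued; products of 1-forms are symmetric products. For either choice of sign (upper or lower signs throughout) put $$\omega_1=\sigma_1+\tfrac{3}{2\sqrt2}e^{\mp ir/3}du,\quad \omega_2=\sigma_2+dr,\quad \omega_3=\sigma_3\pm\tfrac{i}{2\sqrt2}e^{\mp ir/3}du,\quad \omega_4=dr,\quad \omega_5=-\tfrac{3}{2\sqrt2}e^{\mp ir/3}du,$$ $$\bar\omega_1=\sigma_1+\omega_5,\qquad \bar\omega_2=\sigma_2-\omega_4,\qquad \bar\omega_3=\omega_3 .$$ Let $\mathcal D^{\mp}$ be the complex rank 2 distribution spanned by $-\partial_r+E^2$ and $E^1\pm\frac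 i3E^3-\frac{2\sqrt2}{3}e^{\pm ir/3}\partial_u$, and let $\tilde{\mathcal D}^{\mp}$ be the sign-reversed distribution spanned by $\partial_r+E^2$ and $E^1\mp\frac i3E^3+\frac{2\sqrt2}{3}e^{\pm ir/3}\partial_u$. Nurowski's conformal class of a rank 2 distribution $\mathcal D$ is represented by the metrics that are locally nowhere vanishing multiples of $2\theta_1\theta_5-2\theta_2\theta_4+\frac43\theta_3\theta_3$, where $\theta_1,\dots,\theta_5$ is a local coframe such that $\theta_1,\theta_2,\theta_3$ span the annihilator of $\mathcal D$ and, for some 1-forms $\Omega_1,\dots,\Omega_7$, Cartan's structure equations hold: $$\begin{aligned} d\theta_1&=\theta_1\wedge(2\Omega_1+\Omega_4)+\theta_2\wedge\Omega_2+\theta_3\wedge\theta_4,\\ d\theta_2&=\theta_1\wedge\Omega_3+\theta_2\wedge(\Omega_1+2\Omega_4)+\theta_3\wedge\theta_5,\\ d\theta_3&=\theta_1\wedge\Omega_5+\theta_2\wedge\Omega_6+\theta_3\wedge(\Omega_1+\Omega_4)+\theta_4\wedge\theta_5,\\ d\theta_4&=\theta_1\wedge\Omega_7+\tfrac43\theta_3\wedge\Omega_6+\theta_4\wedge\Omega_1+\theta_5\wedge\Omega_2,\\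 d\theta_5&=\theta_2\wedge\Omega_7-\tfrac43\theta_3\wedge\Omega_5+\theta_4\wedge\Omega_3+\theta_5\wedge\Omega_4. \end{aligned}$$ Then $\omega_1,\omega_2,\omega_3$ span the annihilator of $\mathcal D^{\mp}$, $\bar\omega_1,\bar\omega_2,\bar\omega_3$ span the annihilator of $\tilde{\mathcal D}^{\mp}$, and $$\tilde g=-2(\omega_4\omega_4+\omega_5\omega_5)+\tfrac12(\bar\omega_1\bar\omega_1+\bar\omega_2\bar\omega_2+\bar\omega_3\bar\omega_3)+(\omega_1\omega_1+\omega_2\omega_2+\omega_3\omega_3)$$ is a (nondegenerate, complex-valued) metric that represents Nurowski's conformal class of $\mathcal D^{\mp}$. The metric $\tilde g$ has vanishing Weyl tensor and is conformally flat: near every point a rescaling of it by a nowhere vanishing smooth function has vanishing curvature tensor. For every complex constant $\alpha\neq0$, with $\Omega(r)=\alpha e^{\pm ir/3}$ (the sign corresponding to that of $\mathcal D^{\mp}$), the metric $\Omega^2\tilde g$ is a Ricci-flat representative of Nurowski's conformal class of $\mathcal D^{\mp}$. -/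

import Mathlib

open scoped ContDiff Matrix

noncomputable section

namespace NurowskiSU2

/-! ### Complex-valued tensor fields in five real coordinates

A tensor field (a section of a complexified tensor bundle) on an open set of `ℝ⁵` is given by its
complex-valued component functions with respect to the coordinates. -/

/-- Points of the coordinate space. -/
abbrev Pt : Type := Fin 5 → ℝ

/-- Complex covector fields `ω = ∑ ωᵢ dxⁱ`. -/
abbrev OneForm : Type := Pt → Fin 5 → ℂ

/-- Complex vector fields `X = ∑ Xⁱ ∂ᵢ`. -/
abbrev VecField : Type := Pt → Fin 5 → ℂ

/-- Complex bilinear forms `g = ∑ gᵢⱼ dxⁱ ⊗ dxʲ`. -/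
abbrev BilinField : Type := Pt → Matrix (Fin 5) (Fin 5) ℂ

/-- The partial derivative `∂ᵢ F`. -/
def pd (i : Fin 5) (F : Pt → ℂ) (x : Pt) : ℂ := fderiv ℝ F x (Pi.single i 1)

/-- The 1-form is smooth on `V`. -/
def SmoothForm (V : Set Pt) (w : OneForm) : Prop :=
  ∀ i, ContDiffOn ℝ ∞ (fun x => w x i) V

/-- Components `(dw)ᵢⱼ = ∂ᵢ wⱼ - ∂ⱼ wᵢ` of the exterior derivative of a 1-form. -/
def extD (w : OneForm) (x : Pt) : Matrix (Fin 5) (Fin 5) ℂ :=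
  Matrix.of fun i j => pd i (fun y => w y j) x - pd j (fun y => w y i) x

/-- Components `(α ∧ β)ᵢⱼ = αᵢ βⱼ - αⱼ βᵢ` of the wedge product of two covectors. -/
def wedge (a b : Fin 5 → ℂ) : Matrix (Fin 5) (Fin 5) ℂ :=
  Matrix.of fun i j => a i * b j - a j * b i

/-- The symmetric product `αβ = (α ⊗ β + β ⊗ α) / 2` of two covectors. -/
def symProd (a b : Fin 5 → ℂ) : Matrix (Fin 5) (Fin 5) ℂ :=
  Matrix.of fun i j => (a i * b j + b i * a j) / 2

/-- The covectors that vanish on a subspace of the complexified tangent space. -/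
def annihilator (S : Submodule ℂ (Fin 5 → ℂ)) : Submodule ℂ (Fin 5 → ℂ) where
  carrier := {ξ | ∀ v ∈ S, ξ ⬝ᵥ v = 0}
  add_mem' := by
    intro a b ha hb v hv
    rw [add_dotProduct, ha v hv, hb v hv, add_zero]
  zero_mem' := by
    intro v _
    exact zero_dotProduct v
  smul_mem' := by
    intro c a ha v hv
    rw [smul_dotProduct, ha v hv, smul_zero]

/-! ### Curvature of a complex-valued metric -/

/-- A smooth complex-valued metric on `V`: symmetric and nondegenerate at every point. -/
structure IsMetricOn (V : Set Pt) (g : BilinField) : Prop where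
  smooth : ∀ i j, ContDiffOn ℝ ∞ (fun x => g x i j) V
  symm : ∀ x ∈ V, (g x).IsSymm
  nondeg : ∀ x ∈ V, (g x).det ≠ 0

/-- The Christoffel symbols `Γᵏᵢⱼ` of the Levi-Civita connection. -/
def christoffel (g : BilinField) (k i j : Fin 5) (x : Pt) : ℂ :=
  (1 / 2) * ∑ l, (g x)⁻¹ k l *
    (pd i (fun y => g y j l) x + pd j (fun y => g y i l) x - pd l (fun y => g y i j) x)

/-- The curvature tensor `Rˡₖᵢⱼ`, where `R(∂ᵢ, ∂ⱼ) ∂ₖ = ∑ₗ Rˡₖᵢⱼ ∂ₗ`. -/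
def riemann (g : BilinField) (l k i j : Fin 5) (x : Pt) : ℂ :=
  pd i (christoffel g l j k) x - pd j (christoffel g l i k) x
    + ∑ m, (christoffel g l i m x * christoffel g m j k x
      - christoffel g l j m x * christoffel g m i k x)

/-- The Ricci tensor `Ricₖⱼ = ∑ᵢ Rⁱₖᵢⱼ`. -/
def ricci (g : BilinField) (k j : Fin 5) (x : Pt) : ℂ := ∑ i, riemann g i k i j x

/-- The scalar curvature. -/
def scalarCurv (g : BilinField) (x : Pt) : ℂ := ∑ k, ∑ j, (g x)⁻¹ k j * ricci g k j x

/-- The Weyl tensor `Wₗₖᵢⱼ` (all indices lowered) in dimension five. -/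
def weyl (g : BilinField) (l k i j : Fin 5) (x : Pt) : ℂ :=
  (∑ m, g x l m * riemann g m k i j x)
    - (1 / 3) * (g x l i * ricci g k j x - g x l j * ricci g k i x
        + g x k j * ricci g l i x - g x k i * ricci g l j x)
    + (scalarCurv g x / 12) * (g x l i * g x k j - g x l j * g x k i)

/-- The conformal rescaling `lam • g` of a metric by a function. -/
def rescale (lam : Pt → ℂ) (g : BilinField) : BilinField := fun x => lam x • g x

/-- The metric is conformally flat on `W`: near every point of `W` a rescaling of it by a
nowhere vanishing smooth function has vanishing curvature tensor. -/
def IsConformallyFlatOn (W : Set Pt) (g : BilinField) : Prop :=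
  ∀ x ∈ W, ∃ V : Set Pt, IsOpen V ∧ x ∈ V ∧ V ⊆ W ∧ ∃ lam : Pt → ℂ,
    ContDiffOn ℝ ∞ lam V ∧ (∀ y ∈ V, lam y ≠ 0) ∧
    ∀ y ∈ V, ∀ l k i j, riemann (rescale lam g) l k i j y = 0

/-! ### Nurowski's conformal class -/

/-- Cartan's structure equations on `V` for a coframe `θ₁, …, θ₅` (indexed from `0`) and
1-forms `Ω₁, …, Ω₇` (indexed from `0`). -/
structure CartanEquations (V : Set Pt) (θ : Fin 5 → OneForm) (Ω : Fin 7 → OneForm) : Prop where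
  eq1 : ∀ x ∈ V, extD (θ 0) x =
    wedge (θ 0 x) ((2 : ℂ) • Ω 0 x + Ω 3 x) + wedge (θ 1 x) (Ω 1 x) + wedge (θ 2 x) (θ 3 x)
  eq2 : ∀ x ∈ V, extD (θ 1) x =
    wedge (θ 0 x) (Ω 2 x) + wedge (θ 1 x) (Ω 0 x + (2 : ℂ) • Ω 3 x) + wedge (θ 2 x) (θ 4 x)
  eq3 : ∀ x ∈ V, extD (θ 2) x =
    wedge (θ 0 x) (Ω 4 x) + wedge (θ 1 x) (Ω 5 x) + wedge (θ 2 x) (Ω 0 x + Ω 3 x)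
      + wedge (θ 3 x) (θ 4 x)
  eq4 : ∀ x ∈ V, extD (θ 3) x =
    wedge (θ 0 x) (Ω 6 x) + (4 / 3 : ℂ) • wedge (θ 2 x) (Ω 5 x) + wedge (θ 3 x) (Ω 0 x)
      + wedge (θ 4 x) (Ω 1 x)
  eq5 : ∀ x ∈ V, extD (θ 4) x =
    wedge (θ 1 x) (Ω 6 x) - (4 / 3 : ℂ) • wedge (θ 2 x) (Ω 4 x) + wedge (θ 3 x) (Ω 2 x)
      + wedge (θ 4 x) (Ω 3 x)

/-- The metric `2 θ₁θ₅ - 2 θ₂θ₄ + (4/3) θ₃θ₃` of a coframe. -/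
def nurowskiMetric (θ : Fin 5 → OneForm) : BilinField := fun x =>
  (2 : ℂ) • symProd (θ 0 x) (θ 4 x) - (2 : ℂ) • symProd (θ 1 x) (θ 3 x)
    + (4 / 3 : ℂ) • symProd (θ 2 x) (θ 2 x)

/-- `g` represents on `W` Nurowski's conformal class of the rank 2 distribution `D`: near every
point there is a smooth coframe `θ`, adapted to `D` (`θ₁, θ₂, θ₃` span the annihilator of `D`),
that satisfies Cartan's structure equations with suitable `Ω₁, …, Ω₇`, and
`g` is a nowhere vanishing smooth multiple of `2 θ₁θ₅ - 2 θ₂θ₄ + (4/3) θ₃θ₃`. -/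
def RepresentsNurowskiClass (W : Set Pt) (D : Pt → Submodule ℂ (Fin 5 → ℂ))
    (g : BilinField) : Prop :=
  ∀ x ∈ W, ∃ V : Set Pt, IsOpen V ∧ x ∈ V ∧ V ⊆ W ∧
    ∃ (θ : Fin 5 → OneForm) (Ω : Fin 7 → OneForm) (lam : Pt → ℂ),
      (∀ a, SmoothForm V (θ a)) ∧ (∀ a, SmoothForm V (Ω a)) ∧ ContDiffOn ℝ ∞ lam V ∧
      (∀ y ∈ V, LinearIndependent ℂ (fun a => θ a y)) ∧
      (∀ y ∈ V, annihilator (D y) = Submodule.span ℂ {θ 0 y, θ 1 y, θ 2 y}) ∧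
      CartanEquations V θ Ω ∧
      (∀ y ∈ V, lam y ≠ 0) ∧
      ∀ y ∈ V, g y = lam y • nurowskiMetric θ y

/-! ### The manifold `SU(2) × ℝ²` and its standard coframe -/

/-- The basis `(i/2) σₐ` of `su(2)`, with `σₐ` the Pauli matrices. -/
def su2Basis : Fin 3 → Matrix (Fin 2) (Fin 2) ℂ :=
  ![(Complex.I / 2) • !![0, 1; 1, 0],
    (Complex.I / 2) • !![0, -Complex.I; Complex.I, 0],
    (Complex.I / 2) • !![1, 0; 0, -1]]

/-- A local parametrisation of `M = SU(2) × ℝ²`, where `SU(2) = S³` and `r`, `u` are the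
coordinates of the second factor: a smooth immersion into `M` of an open subset of `ℝ⁵`. As `M`
has dimension five, this is a local diffeomorphism; the inverses of charts of `M` are of
this kind. -/
structure LocalParam where
  /-- the domain of the parametrisation -/
  dom : Set Pt
  isOpen_dom : IsOpen dom
  /-- the component in `SU(2)` -/
  p : Pt → Matrix.specialUnitaryGroup (Fin 2) ℂ
  /-- the coordinate `r` -/
  r : Pt → ℝ
  /-- the coordinate `u` -/
  u : Pt → ℝ
  smooth_p : ∀ a b, ContDiffOn ℝ ∞ (fun x => (p x : Matrix (Fin 2) (Fin 2) ℂ) a b) dom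
  smooth_r : ContDiffOn ℝ ∞ r dom
  smooth_u : ContDiffOn ℝ ∞ u dom
  immersion : ∀ x ∈ dom, ∀ v : Fin 5 → ℝ,
    (∀ a b, fderiv ℝ (fun y => (p y : Matrix (Fin 2) (Fin 2) ℂ) a b) x v = 0) →
    fderiv ℝ r x v = 0 → fderiv ℝ u x v = 0 → v = 0

namespace LocalParam

variable (Φ : LocalParam)

/-- The matrix `∂ᵢ p` of derivatives of the `SU(2)` component. -/
def dp (i : Fin 5) (x : Pt) : Matrix (Fin 2) (Fin 2) ℂ :=
  Matrix.of fun a b => pd i (fun y => (Φ.p y : Matrix (Fin 2) (Fin 2) ℂ) a b) x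

/-- The left-invariant 1-forms on `SU(2)`: the coefficients of the Maurer-Cartan form
`p⁻¹ dp = ∑ₐ σₐ ξₐ` in the basis `ξₐ = su2Basis a`, for which `tr (ξₐᴴ ξ_b) = δ_ab / 2`. -/
def sigma (a : Fin 3) : OneForm := fun x i =>
  2 * ((su2Basis a)ᴴ * ((Φ.p x : Matrix (Fin 2) (Fin 2) ℂ)ᴴ * Φ.dp i x)).trace

/-- The 1-form `dr`. -/
def dr : OneForm := fun x i => pd i (fun y => (Φ.r y : ℂ)) x

/-- The 1-form `du`. -/
def du : OneForm := fun x i => pd i (fun y => (Φ.u y : ℂ)) x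

/-- The matrix whose rows are `σ₁, σ₂, σ₃, dr, du`. -/
def coframe (x : Pt) : Matrix (Fin 5) (Fin 5) ℂ :=
  Matrix.of ![Φ.sigma 0 x, Φ.sigma 1 x, Φ.sigma 2 x, Φ.dr x, Φ.du x]

/-- The frame `E¹, E², E³, ∂_r, ∂_u` dual to `σ₁, σ₂, σ₃, dr, du`. -/
def frame (b : Fin 5) : VecField := fun x i => (Φ.coframe x)⁻¹ i b

/-- The left-invariant vector field `E¹`. -/
def E1 : VecField := Φ.frame 0

/-- The left-invariant vector field `E²`. -/
def E2 : VecField := Φ.frame 1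

/-- The left-invariant vector field `E³`. -/
def E3 : VecField := Φ.frame 2

/-- The vector field `∂/∂r`. -/
def partialR : VecField := Φ.frame 3

/-- The vector field `∂/∂u`. -/
def partialU : VecField := Φ.frame 4

/-! ### The distributions, Pfaffian systems and metric

The number `ε = ±1` is the sign: `ε = 1` gives `D⁻` (the upper signs), `ε = -1` gives `D⁺`. -/

/-- The phase `e^{ε i r / 3}`. -/
def phase (ε : ℂ) (x : Pt) : ℂ := Complex.exp (ε * (Complex.I / 3) * (Φ.r x : ℂ))

/-- The complex number `√2`. -/
def sqrtTwo : ℂ := ((Real.sqrt 2 : ℝ) : ℂ)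

/-- `-∂_r + E²` -/
def X1 : VecField := fun x => -Φ.partialR x + Φ.E2 x

/-- `E¹ ± (i/3) E³ - (2√2/3) e^{± i r / 3} ∂_u` -/
def X2 (ε : ℂ) : VecField := fun x =>
  Φ.E1 x + (ε * (Complex.I / 3)) • Φ.E3 x - ((2 * sqrtTwo / 3) * Φ.phase ε x) • Φ.partialU x

/-- `∂_r + E²` -/
def X1Tilde : VecField := fun x => Φ.partialR x + Φ.E2 x

/-- `E¹ ∓ (i/3) E³ + (2√2/3) e^{± i r / 3} ∂_u` -/
def X2Tilde (ε : ℂ) : VecField := fun x =>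
  Φ.E1 x - (ε * (Complex.I / 3)) • Φ.E3 x + ((2 * sqrtTwo / 3) * Φ.phase ε x) • Φ.partialU x

/-- The complex distribution `D^∓`. -/
def distr (ε : ℂ) (x : Pt) : Submodule ℂ (Fin 5 → ℂ) := Submodule.span ℂ {Φ.X1 x, Φ.X2 ε x}

/-- The sign-reversed complex distribution. -/
def distrTilde (ε : ℂ) (x : Pt) : Submodule ℂ (Fin 5 → ℂ) :=
  Submodule.span ℂ {Φ.X1Tilde x, Φ.X2Tilde ε x}

/-- `ω₁ = σ₁ + (3 / (2√2)) e^{∓ i r / 3} du` -/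
def omega1 (ε : ℂ) : OneForm := fun x =>
  Φ.sigma 0 x + ((3 / (2 * sqrtTwo)) * Φ.phase (-ε) x) • Φ.du x

/-- `ω₂ = σ₂ + dr` -/
def omega2 : OneForm := fun x => Φ.sigma 1 x + Φ.dr x

/-- `ω₃ = σ₃ ± (i / (2√2)) e^{∓ i r / 3} du` -/
def omega3 (ε : ℂ) : OneForm := fun x =>
  Φ.sigma 2 x + (ε * (Complex.I / (2 * sqrtTwo)) * Φ.phase (-ε) x) • Φ.du x

/-- `ω₄ = dr` -/
def omega4 : OneForm := Φ.dr

/-- `ω₅ = -(3 / (2√2)) e^{∓ i r / 3} du` -/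
def omega5 (ε : ℂ) : OneForm := fun x =>
  (-((3 / (2 * sqrtTwo)) * Φ.phase (-ε) x)) • Φ.du x

/-- `ω̄₁ = σ₁ + ω₅` -/
def omegaBar1 (ε : ℂ) : OneForm := fun x => Φ.sigma 0 x + Φ.omega5 ε x

/-- `ω̄₂ = σ₂ - ω₄` -/
def omegaBar2 : OneForm := fun x => Φ.sigma 1 x - Φ.omega4 x

/-- `ω̄₃ = ω₃` -/
def omegaBar3 (ε : ℂ) : OneForm := Φ.omega3 ε

/-- `-2 (ω₄² + ω₅²) + (1/2) (ω̄₁² + ω̄₂² + ω̄₃²) + (ω₁² + ω₂² + ω₃²)` -/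
def gTilde (ε : ℂ) : BilinField := fun x =>
  (-2 : ℂ) • (symProd (Φ.omega4 x) (Φ.omega4 x) + symProd (Φ.omega5 ε x) (Φ.omega5 ε x))
    + (1 / 2 : ℂ) • (symProd (Φ.omegaBar1 ε x) (Φ.omegaBar1 ε x)
      + symProd (Φ.omegaBar2 x) (Φ.omegaBar2 x)
      + symProd (Φ.omegaBar3 ε x) (Φ.omegaBar3 ε x))
    + (symProd (Φ.omega1 ε x) (Φ.omega1 ε x) + symProd (Φ.omega2 x) (Φ.omega2 x)
      + symProd (Φ.omega3 ε x) (Φ.omega3 ε x))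

end LocalParam

end NurowskiSU2

end

noncomputable section

namespace NurowskiSU2

/-! ### Partial derivatives -/

section Calculus

variable {V : Set Pt} {F G : Pt → ℂ} {x : Pt}

/-! Put ν = (3/(2√2)) e^{∓ir/3} du. Since dν = ∓(i/3) dr ∧ ν, the forms σ₁, σ₂, σ₃, dr, ν span a
space closed under d with constant coefficients, and every ω, the metric g̃ and the pairings with
the generators of both distributions have constant coefficients in this coframe. The annihilators
and the membership in Nurowski's class thereby become finite linear algebra: an explicit
constant-coefficient coframe (`cartanCoframe`) with constant-coefficient connection forms
(`cartanConnection`) satisfies Cartan's equations, and its metric is (9/8) g̃.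

The curvature claims come from explicit flat coordinates. With s = e^{±ir/6}, the ℂ²-valued
functions W = s p(1, ∓i) and Z = s³ p(1, ±i) + κ u W, for a suitable constant κ, satisfy e^{±2ir/3}
g̃ = ±3i (dZ₀ dW₁ - dZ₁ dW₀) - (3/4) du². Diagonalising this constant quadratic form gives five
complex functions y with e^{±2ir/3} g̃ = ∑ (dyᵃ)² (`phase_sq_mul_gTilde`). Hence Ω² g̃ is a constant
multiple of a flat metric: its whole curvature tensor vanishes, in particular its Ricci tensor, and
g̃ is conformally flat.

The functions y are complex on a real domain, so they are not a chart, and flatness is not a change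
of variables. `ConformalCoords` therefore computes the Levi-Civita connection and curvature of f ∑
(dyᵃ)² through the Jacobian of y. The curvature is a Kulkarni-Nomizu product of g with a symmetric
tensor (`ConformalCoords.riemann_eq`). That tensor is zero for constant f, and for any f of the
required form the Weyl tensor vanishes. For g̃ itself f = e^{∓2ir/3}, which is a function of y
because y₀² + y₁² + y₂² + y₃² = 6 e^{±2ir/3} (`flatCoords_sq`). -/

theorem pd_congr (hV : IsOpen V) (hx : x ∈ V) (h : ∀ y ∈ V, F y = G y) (i : Fin 5) :
    pd i F x = pd i G x := by
  unfold pd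
  rw [Filter.EventuallyEq.fderiv_eq]
  filter_upwards [hV.mem_nhds hx] with y hy using h y hy

theorem smooth_differentiableAt (hV : IsOpen V) (hF : ContDiffOn ℝ ∞ F V) (hx : x ∈ V) :
    DifferentiableAt ℝ F x :=
  (hF.contDiffAt (hV.mem_nhds hx)).differentiableAt (by simp)

theorem contDiffOn_pd (hV : IsOpen V) (hF : ContDiffOn ℝ ∞ F V) (i : Fin 5) :
    ContDiffOn ℝ ∞ (pd i F) V := by
  have h : ContDiffOn ℝ ∞ (fderiv ℝ F) V := hF.fderiv_of_isOpen hV (by simp)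
  exact h.clm_apply contDiffOn_const

theorem pd_comm (hV : IsOpen V) (hF : ContDiffOn ℝ ∞ F V) (hx : x ∈ V) (i j : Fin 5) :
    pd i (pd j F) x = pd j (pd i F) x := by
  have h : ContDiffOn ℝ ∞ (fderiv ℝ F) V := hF.fderiv_of_isOpen hV (by simp)
  have hd : DifferentiableAt ℝ (fderiv ℝ F) x :=
    (h.contDiffAt (hV.mem_nhds hx)).differentiableAt (by simp)
  have key : ∀ i j : Fin 5, pd i (pd j F) x =
      fderiv ℝ (fderiv ℝ F) x (Pi.single i 1) (Pi.single j 1) := by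
    intro i j
    change fderiv ℝ (fun y => fderiv ℝ F y (Pi.single j 1)) x (Pi.single i 1) = _
    rw [fderiv_clm_apply hd (differentiableAt_const _)]
    simp
  have hs : IsSymmSndFDerivAt ℝ F x :=
    (hF.contDiffAt (hV.mem_nhds hx)).isSymmSndFDerivAt (by
      rw [minSmoothness_of_isRCLikeNormedField]
      exact WithTop.coe_le_coe.mpr le_top)
  rw [key, key]
  exact hs _ _

theorem pd_const (c : ℂ) (i : Fin 5) : pd i (fun _ => c) x = 0 := by
  simp [pd]

theorem pd_add (hF : DifferentiableAt ℝ F x) (hG : DifferentiableAt ℝ G x) (i : Fin 5) :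
    pd i (fun y => F y + G y) x = pd i F x + pd i G x := by
  unfold pd
  rw [fderiv_fun_add hF hG]
  rfl

theorem pd_sub (hF : DifferentiableAt ℝ F x) (hG : DifferentiableAt ℝ G x) (i : Fin 5) :
    pd i (fun y => F y - G y) x = pd i F x - pd i G x := by
  unfold pd
  rw [fderiv_fun_sub hF hG]
  rfl

theorem pd_mul (hF : DifferentiableAt ℝ F x) (hG : DifferentiableAt ℝ G x) (i : Fin 5) :
    pd i (fun y => F y * G y) x = pd i F x * G x + F x * pd i G x := by
  unfold pd
  rw [fderiv_fun_mul hF hG]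
  simp
  ring

theorem pd_const_mul (c : ℂ) (hF : DifferentiableAt ℝ F x) (i : Fin 5) :
    pd i (fun y => c * F y) x = c * pd i F x := by
  rw [pd_mul (differentiableAt_const c) hF, pd_const]
  ring

theorem pd_exp (hF : DifferentiableAt ℝ F x) (i : Fin 5) :
    pd i (fun y => Complex.exp (F y)) x = Complex.exp (F x) * pd i F x := by
  unfold pd
  rw [hF.hasFDerivAt.cexp.fderiv]
  rfl

theorem pd_sum {ι : Type*} (s : Finset ι) {F : ι → Pt → ℂ}
    (hF : ∀ a ∈ s, DifferentiableAt ℝ (F a) x) (i : Fin 5) :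
    pd i (fun y => ∑ a ∈ s, F a y) x = ∑ a ∈ s, pd i (F a) x := by
  unfold pd
  rw [fderiv_fun_sum hF]
  simp

end Calculus

/-- The derivative of a vector-valued function, component by component. -/
def pdVec (i : Fin 5) (v : Pt → Fin 5 → ℂ) (x : Pt) : Fin 5 → ℂ :=
  fun a => pd i (fun y => v y a) x

section PdVec

variable {V : Set Pt} {u v w : Pt → Fin 5 → ℂ} {x : Pt}

theorem smoothForm_pdVec (hV : IsOpen V) (hv : SmoothForm V v) (i : Fin 5) :
    SmoothForm V (pdVec i v) := fun a => contDiffOn_pd hV (hv a) i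

theorem contDiffOn_dotProduct (hu : SmoothForm V u) (hv : SmoothForm V v) :
    ContDiffOn ℝ ∞ (fun x => u x ⬝ᵥ v x) V := by
  unfold dotProduct
  exact ContDiffOn.sum fun a _ => (hu a).mul (hv a)

theorem pd_dotProduct (hu : ∀ a, DifferentiableAt ℝ (fun y => u y a) x)
    (hv : ∀ a, DifferentiableAt ℝ (fun y => v y a) x) (i : Fin 5) :
    pd i (fun y => u y ⬝ᵥ v y) x = pdVec i u x ⬝ᵥ v x + u x ⬝ᵥ pdVec i v x := by
  unfold dotProduct
  rw [pd_sum (F := fun a y => u y a * v y a) _ fun a _ => (hu a).mul (hv a),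
    ← Finset.sum_add_distrib]
  exact Finset.sum_congr rfl fun a _ => pd_mul (hu a) (hv a) i

theorem pdVec_add (hu : ∀ a, DifferentiableAt ℝ (fun y => u y a) x)
    (hv : ∀ a, DifferentiableAt ℝ (fun y => v y a) x) (i : Fin 5) :
    pdVec i (fun y => u y + v y) x = pdVec i u x + pdVec i v x :=
  funext fun a => pd_add (hu a) (hv a) i

theorem pdVec_sub (hu : ∀ a, DifferentiableAt ℝ (fun y => u y a) x)
    (hv : ∀ a, DifferentiableAt ℝ (fun y => v y a) x) (i : Fin 5) :
    pdVec i (fun y => u y - v y) x = pdVec i u x - pdVec i v x :=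
  funext fun a => pd_sub (hu a) (hv a) i

theorem pdVec_smul {F : Pt → ℂ} (hF : DifferentiableAt ℝ F x)
    (hv : ∀ a, DifferentiableAt ℝ (fun y => v y a) x) (i : Fin 5) :
    pdVec i (fun y => F y • v y) x = pd i F x • v x + F x • pdVec i v x :=
  funext fun a => pd_mul hF (hv a) i

end PdVec

/-! ### Smoothness of the Christoffel symbols -/

theorem contDiffOn_det {V : Set Pt} {g : BilinField}
    (hg : ∀ i j, ContDiffOn ℝ ∞ (fun x => g x i j) V) :
    ContDiffOn ℝ ∞ (fun x => (g x).det) V := by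
  simp only [Matrix.det_apply']
  exact ContDiffOn.sum fun σ _ => contDiffOn_const.mul (contDiffOn_prod fun i _ => hg _ _)

theorem contDiffOn_inv {V : Set Pt} {g : BilinField}
    (hg : ∀ i j, ContDiffOn ℝ ∞ (fun x => g x i j) V) (hdet : ∀ x ∈ V, (g x).det ≠ 0)
    (i j : Fin 5) : ContDiffOn ℝ ∞ (fun x => (g x)⁻¹ i j) V := by
  have hadj : ContDiffOn ℝ ∞ (fun x => (g x).adjugate i j) V := by
    simp only [Matrix.adjugate_apply]
    refine contDiffOn_det fun k l => ?_
    by_cases hk : k = j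
    · subst hk
      simp only [Matrix.updateRow_self]
      exact contDiffOn_const
    · simp only [Matrix.updateRow_ne hk]
      exact hg k l
  have : (fun x => (g x)⁻¹ i j) = fun x => ((g x).det)⁻¹ * (g x).adjugate i j := by
    funext x
    rw [Matrix.inv_def, Ring.inverse_eq_inv']
    rfl
  rw [this]
  exact ((contDiffOn_det hg).inv hdet).mul hadj

theorem contDiffOn_christoffel {V : Set Pt} (hV : IsOpen V) {g : BilinField}
    (hg : IsMetricOn V g) (k i j : Fin 5) : ContDiffOn ℝ ∞ (christoffel g k i j) V := by
  unfold christoffel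
  refine contDiffOn_const.mul (ContDiffOn.sum fun l _ => ?_)
  exact (contDiffOn_inv hg.smooth hg.nondeg k l).mul
    (((contDiffOn_pd hV (hg.smooth j l) i).add (contDiffOn_pd hV (hg.smooth i l) j)).sub
      (contDiffOn_pd hV (hg.smooth i j) l))

/-! ### Curvature of the form `g ∧ P` (Kulkarni-Nomizu) -/

/-- If the curvature tensor is the Kulkarni-Nomizu product of the metric with a symmetric
tensor, then the Weyl tensor vanishes. -/
theorem weyl_eq_zero_of_riemann_eq {g : BilinField} {x : Pt} (hs : (g x).IsSymm)
    (hdet : (g x).det ≠ 0) (P : Matrix (Fin 5) (Fin 5) ℂ) (hP : P.IsSymm)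
    (h : ∀ l k i j, ∑ m, g x l m * riemann g m k i j x =
      g x l i * P k j - g x l j * P k i + g x k j * P l i - g x k i * P l j) (l k i j : Fin 5) :
    weyl g l k i j x = 0 := by
  have hu : IsUnit (g x).det := isUnit_iff_ne_zero.mpr hdet
  set B : Matrix (Fin 5) (Fin 5) ℂ := (g x)⁻¹ with hB
  have hBg : ∀ a b, ∑ m, B a m * g x m b = if a = b then 1 else 0 := fun a b => by
    have := congrFun (congrFun (Matrix.nonsing_inv_mul (g x) hu) a) b
    rwa [Matrix.mul_apply, Matrix.one_apply] at this
  have hBs : ∀ a b, B a b = B b a := fun a b => by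
    have : Bᵀ = B := by rw [hB, Matrix.transpose_nonsing_inv, hs.eq]
    exact (congrFun (congrFun this b) a)
  have hgs : ∀ a b, g x a b = g x b a := fun a b => hs.apply b a
  have hPs : ∀ a b, P a b = P b a := fun a b => hP.apply b a
  -- The hypothesis has the first index lowered; contracting with the inverse metric raises it.
  have hR : ∀ n k i j, riemann g n k i j x = ∑ l, B n l *
      (g x l i * P k j - g x l j * P k i + g x k j * P l i - g x k i * P l j) := by
    intro n k i j
    simp only [← h, Finset.mul_sum, ← mul_assoc]
    rw [Finset.sum_comm]
    simp only [← Finset.sum_mul, hBg]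
    simp
  have hR' : ∀ n k i j, riemann g n k i j x = (if n = i then 1 else 0) * P k j
      - (if n = j then 1 else 0) * P k i + g x k j * (∑ l, B n l * P l i)
      - g x k i * (∑ l, B n l * P l j) := by
    intro n k i j
    rw [hR, ← hBg, ← hBg]
    simp only [mul_sub, mul_add, Finset.sum_sub_distrib, Finset.sum_add_distrib,
      Finset.sum_mul, Finset.mul_sum]
    congr 1
    · congr 1
      · congr 1 <;> exact Finset.sum_congr rfl fun _ _ => by ring
      · exact Finset.sum_congr rfl fun _ _ => by ring
    · exact Finset.sum_congr rfl fun _ _ => by ring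
  set t : ℂ := ∑ n, ∑ l, B n l * P l n with ht
  -- Contraction in dimension n = 5 yields (n - 2) P + (tr P) g, where t = tr P.
  have hRic : ∀ k j, ricci g k j x = 3 * P k j + t * g x k j := by
    intro k j
    unfold ricci
    simp only [hR', Finset.sum_sub_distrib, Finset.sum_add_distrib, ← Finset.mul_sum]
    have h1 : ∑ n, g x k n * ∑ l, B n l * P l j = P k j := by
      simp only [Finset.mul_sum, ← mul_assoc]
      rw [Finset.sum_comm]
      simp only [← Finset.sum_mul]
      have : ∀ l, ∑ n, g x k n * B n l = if l = k then 1 else 0 := fun l => by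
        rw [← hBg]
        exact Finset.sum_congr rfl fun n _ => by rw [hBs n l, hgs k n]; ring
      simp [this]
    rw [h1]
    simp [← ht]
    ring
  -- The second trace is 2(n - 1) tr P = 8t, so in the Weyl tensor the multiples of t cancel: -2t/3
  -- from the Ricci terms and 8t/12 from the scalar term.
  have hsc : scalarCurv g x = 8 * t := by
    unfold scalarCurv
    have h1 : ∑ k, ∑ j, B k j * P k j = t :=
      Finset.sum_congr rfl fun k _ => Finset.sum_congr rfl fun j _ => by rw [hPs k j]
    have h2 : ∑ k, ∑ j, B k j * g x k j = 5 := by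
      have : ∀ k, ∑ j, B k j * g x k j = 1 := fun k => by
        have := hBg k k
        simp only [if_true] at this
        rw [← this]
        exact Finset.sum_congr rfl fun j _ => by rw [hgs k j]
      simp [this]
    have h3 : ∀ k j, B k j * ricci g k j x = 3 * (B k j * P k j) + t * (B k j * g x k j) :=
      fun k j => by rw [hRic]; ring
    rw [← hB]
    simp only [h3, Finset.sum_add_distrib, ← Finset.mul_sum]
    rw [h1, h2]
    ring
  unfold weyl
  rw [h, hsc, hRic, hRic, hRic, hRic]
  ring

/-! ### Metrics conformal to a metric with flat complex coordinates -/

/-- The metric `g = f ∑ₐ (dyᵃ)²` on `V`, for complex-valued functions `yᵃ`, with a conformal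
factor satisfying `df = 2 f ∑ₐ ψₐ dyᵃ` and `dψₐ = ∑_b Hₐ_b dyᵇ`, where `H` is symmetric. -/
structure ConformalCoords (V : Set Pt) (g : BilinField) (y ψ : Pt → Fin 5 → ℂ)
    (f : Pt → ℂ) (H : BilinField) : Prop where
  isOpen : IsOpen V
  isMetric : IsMetricOn V g
  smooth_y : SmoothForm V y
  smooth_ψ : SmoothForm V ψ
  smooth_f : ContDiffOn ℝ ∞ f V
  g_eq : ∀ x ∈ V, ∀ i j, g x i j = f x * (pdVec i y x ⬝ᵥ pdVec j y x)
  pd_f : ∀ x ∈ V, ∀ i, pd i f x = 2 * f x * (ψ x ⬝ᵥ pdVec i y x)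
  pd_ψ : ∀ x ∈ V, ∀ i, pdVec i ψ x = H x *ᵥ pdVec i y x
  symm : ∀ x ∈ V, (H x).IsSymm

namespace ConformalCoords

variable {V : Set Pt} {g : BilinField} {y ψ : Pt → Fin 5 → ℂ} {f : Pt → ℂ} {H : BilinField}
  {x : Pt}

/-- The tensor whose Kulkarni-Nomizu product with `g` is the curvature. -/
def potential (y ψ : Pt → Fin 5 → ℂ) (H : BilinField) (x : Pt) : Matrix (Fin 5) (Fin 5) ℂ :=
  Matrix.of fun k j => (ψ x ⬝ᵥ pdVec k y x) * (ψ x ⬝ᵥ pdVec j y x)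
    - (1 / 2) * (ψ x ⬝ᵥ ψ x) * (pdVec k y x ⬝ᵥ pdVec j y x)
    - (H x *ᵥ pdVec j y x) ⬝ᵥ pdVec k y x

/-- The image under `dy` of the covariant derivative of `∂ⱼ` along `∂ᵢ`. -/
def push (y ψ : Pt → Fin 5 → ℂ) (i j : Fin 5) (x : Pt) : Fin 5 → ℂ :=
  pdVec i (pdVec j y) x + (ψ x ⬝ᵥ pdVec i y x) • pdVec j y x
    + (ψ x ⬝ᵥ pdVec j y x) • pdVec i y x - (pdVec i y x ⬝ᵥ pdVec j y x) • ψ x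

/-- The matrix with columns `∂ᵢ y`. -/
def jac (y : Pt → Fin 5 → ℂ) (x : Pt) : Matrix (Fin 5) (Fin 5) ℂ :=
  Matrix.of fun a i => pdVec i y x a

theorem g_eq_mul (h : ConformalCoords V g y ψ f H) (hx : x ∈ V) :
    g x = f x • ((jac y x)ᵀ * jac y x) := by
  ext i j
  rw [h.g_eq x hx]
  rfl

/-- The matrix is a factor of the nondegenerate g = f JᵀJ. Invertibility lets vector identities be
checked after pairing with all ∂ₗy, as in the Koszul formula. -/
theorem isUnit_transpose (h : ConformalCoords V g y ψ f H) (hx : x ∈ V) :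
    IsUnit (f x • (jac y x)ᵀ) := by
  have hd := h.isMetric.nondeg x hx
  rw [h.g_eq_mul hx, ← Matrix.smul_mul, Matrix.det_mul] at hd
  exact (Matrix.isUnit_iff_isUnit_det _).mpr (isUnit_iff_ne_zero.mpr (left_ne_zero_of_mul hd))

theorem diff_ψ (h : ConformalCoords V g y ψ f H) (hx : x ∈ V) (a : Fin 5) :
    DifferentiableAt ℝ (fun z => ψ z a) x :=
  smooth_differentiableAt h.isOpen (h.smooth_ψ a) hx

theorem smooth_pd (h : ConformalCoords V g y ψ f H) (i : Fin 5) : SmoothForm V (pdVec i y) :=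
  smoothForm_pdVec h.isOpen h.smooth_y i

theorem diff_pd (h : ConformalCoords V g y ψ f H) (hx : x ∈ V) (i a : Fin 5) :
    DifferentiableAt ℝ (fun z => pdVec i y z a) x :=
  smooth_differentiableAt h.isOpen (h.smooth_pd i a) hx

theorem diff_pd_pd (h : ConformalCoords V g y ψ f H) (hx : x ∈ V) (i j a : Fin 5) :
    DifferentiableAt ℝ (fun z => pdVec i (pdVec j y) z a) x :=
  smooth_differentiableAt h.isOpen (smoothForm_pdVec h.isOpen (h.smooth_pd j) i a) hx

theorem pdVec_comm (h : ConformalCoords V g y ψ f H) (hx : x ∈ V) (i j : Fin 5) :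
    pdVec i (pdVec j y) x = pdVec j (pdVec i y) x :=
  funext fun a => pd_comm h.isOpen (h.smooth_y a) hx i j

theorem pdVec_pdVec_comm (h : ConformalCoords V g y ψ f H) (hx : x ∈ V) (i j k : Fin 5) :
    pdVec i (pdVec j (pdVec k y)) x = pdVec j (pdVec i (pdVec k y)) x :=
  funext fun a => pd_comm h.isOpen (h.smooth_pd k a) hx i j

theorem pd_g (h : ConformalCoords V g y ψ f H) (hx : x ∈ V) (i j k : Fin 5) :
    pd i (fun z => g z j k) x = 2 * f x * (ψ x ⬝ᵥ pdVec i y x) * (pdVec j y x ⬝ᵥ pdVec k y x)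
      + f x * (pdVec i (pdVec j y) x ⬝ᵥ pdVec k y x + pdVec j y x ⬝ᵥ pdVec i (pdVec k y) x) := by
  rw [pd_congr h.isOpen hx (fun z hz => h.g_eq z hz j k), pd_mul
    (smooth_differentiableAt h.isOpen h.smooth_f hx)
    (smooth_differentiableAt h.isOpen (contDiffOn_dotProduct (h.smooth_pd j) (h.smooth_pd k)) hx),
    pd_dotProduct (h.diff_pd hx j) (h.diff_pd hx k), h.pd_f x hx]

/-- The vector `push` is the flat second derivative of y plus the usual correction for a conformal
factor with half logarithmic gradient ψ. Multiplied by f Jᵀ, both sides become the lowered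
Christoffel symbols: the left by definition, the right by differentiating g = f ∂y·∂y and using
symmetry of second derivatives. -/
theorem jac_mulVec_christoffel (h : ConformalCoords V g y ψ f H) (hx : x ∈ V) (i j : Fin 5) :
    jac y x *ᵥ (fun m => christoffel g m i j x) = push y ψ i j x := by
  set c : Fin 5 → ℂ := fun l => (1 / 2) *
    (pd i (fun z => g z j l) x + pd j (fun z => g z i l) x - pd l (fun z => g z i j) x) with hc
  have h1 : (fun m => christoffel g m i j x) = (g x)⁻¹ *ᵥ c := by
    funext m
    simp only [christoffel, Matrix.mulVec, dotProduct, hc, Finset.mul_sum]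
    exact Finset.sum_congr rfl fun l _ => by ring
  have h2 : g x *ᵥ (fun m => christoffel g m i j x) = c := by
    rw [h1, Matrix.mulVec_mulVec, Matrix.mul_nonsing_inv _
      (isUnit_iff_ne_zero.mpr (h.isMetric.nondeg x hx)), Matrix.one_mulVec]
  have h3 : (f x • (jac y x)ᵀ) *ᵥ push y ψ i j x = c := by
    funext l
    have : ((f x • (jac y x)ᵀ) *ᵥ push y ψ i j x) l = f x * (pdVec l y x ⬝ᵥ push y ψ i j x) := by
      rw [Matrix.smul_mulVec]
      rfl
    rw [this]
    simp only [hc, h.pd_g hx, push, dotProduct_add, dotProduct_sub, dotProduct_smul, smul_eq_mul]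
    rw [h.pdVec_comm hx l i, h.pdVec_comm hx l j, h.pdVec_comm hx j i,
      dotProduct_comm (pdVec l y x) (pdVec i (pdVec j y) x),
      dotProduct_comm (pdVec l y x) (pdVec j y x), dotProduct_comm (pdVec l y x) (pdVec i y x),
      dotProduct_comm (pdVec l y x) (ψ x), dotProduct_comm (pdVec i (pdVec l y) x) (pdVec j y x)]
    ring
  rw [h.g_eq_mul hx, ← Matrix.smul_mul, ← Matrix.mulVec_mulVec] at h2
  exact Matrix.mulVec_injective_of_isUnit (h.isUnit_transpose hx) (h2.trans h3.symm)

theorem smooth_christoffel (h : ConformalCoords V g y ψ f H) (i j : Fin 5) :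
    SmoothForm V (fun x m => christoffel g m i j x) := fun m =>
  contDiffOn_christoffel h.isOpen h.isMetric m i j

theorem jac_mulVec_eq_sum (v : Fin 5 → ℂ) : jac y x *ᵥ v = ∑ m, v m • pdVec m y x := by
  funext a
  simp only [Matrix.mulVec, dotProduct, jac, Matrix.of_apply, Finset.sum_apply, Pi.smul_apply,
    smul_eq_mul]
  exact Finset.sum_congr rfl fun m _ => mul_comm _ _

/-- Product rule applied to J Γ = `push`; the sum is the term in which the derivative falls on J. -/
theorem jac_mulVec_pd_christoffel (h : ConformalCoords V g y ψ f H) (hx : x ∈ V)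
    (i j k : Fin 5) :
    jac y x *ᵥ (pdVec i (fun z m => christoffel g m j k z) x) =
      pdVec i (push y ψ j k) x
        - ∑ m, christoffel g m j k x • pdVec i (pdVec m y) x := by
  rw [eq_sub_iff_add_eq]
  funext a
  have h1 : pd i (fun z => ∑ m, christoffel g m j k z * pdVec m y z a) x =
      pd i (fun z => push y ψ j k z a) x := by
    refine pd_congr h.isOpen hx (fun z hz => ?_) i
    rw [← h.jac_mulVec_christoffel hz, jac_mulVec_eq_sum]
    simp [Finset.sum_apply]
  have hd : ∀ m, DifferentiableAt ℝ (christoffel g m j k) x := fun m =>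
    smooth_differentiableAt h.isOpen (h.smooth_christoffel j k m) hx
  rw [pd_sum (F := fun m z => christoffel g m j k z * pdVec m y z a) _
    fun m _ => (hd m).mul (h.diff_pd hx m a)] at h1
  rw [jac_mulVec_eq_sum]
  simp only [Pi.add_apply, Finset.sum_apply, Pi.smul_apply, smul_eq_mul]
  rw [← Finset.sum_add_distrib]
  refine Eq.trans (Finset.sum_congr rfl fun m _ => ?_) h1
  rw [pd_mul (hd m) (h.diff_pd hx m a)]
  rfl

theorem pdVec_push (h : ConformalCoords V g y ψ f H) (hx : x ∈ V) (i j k : Fin 5) :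
    pdVec i (push y ψ j k) x = pdVec i (pdVec j (pdVec k y)) x
      + (((H x *ᵥ pdVec i y x) ⬝ᵥ pdVec j y x + ψ x ⬝ᵥ pdVec i (pdVec j y) x) • pdVec k y x
        + (ψ x ⬝ᵥ pdVec j y x) • pdVec i (pdVec k y) x)
      + (((H x *ᵥ pdVec i y x) ⬝ᵥ pdVec k y x + ψ x ⬝ᵥ pdVec i (pdVec k y) x) • pdVec j y x
        + (ψ x ⬝ᵥ pdVec k y x) • pdVec i (pdVec j y) x)
      - ((pdVec i (pdVec j y) x ⬝ᵥ pdVec k y x + pdVec j y x ⬝ᵥ pdVec i (pdVec k y) x) • ψ x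
        + (pdVec j y x ⬝ᵥ pdVec k y x) • (H x *ᵥ pdVec i y x)) := by
  have hs : ∀ {u v : Pt → Fin 5 → ℂ}, SmoothForm V u → SmoothForm V v →
      DifferentiableAt ℝ (fun z => u z ⬝ᵥ v z) x := fun hu hv =>
    smooth_differentiableAt h.isOpen (contDiffOn_dotProduct hu hv) hx
  have d1 := fun a => h.diff_pd_pd hx j k a
  have e2 := hs h.smooth_ψ (h.smooth_pd j)
  have d2 : ∀ a, DifferentiableAt ℝ (fun z => ((ψ z ⬝ᵥ pdVec j y z) • pdVec k y z) a) x :=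
    fun a => e2.mul (h.diff_pd hx k a)
  have e3 := hs h.smooth_ψ (h.smooth_pd k)
  have d3 : ∀ a, DifferentiableAt ℝ (fun z => ((ψ z ⬝ᵥ pdVec k y z) • pdVec j y z) a) x :=
    fun a => e3.mul (h.diff_pd hx j a)
  have e4 := hs (h.smooth_pd j) (h.smooth_pd k)
  have d4 : ∀ a, DifferentiableAt ℝ (fun z => ((pdVec j y z ⬝ᵥ pdVec k y z) • ψ z) a) x :=
    fun a => e4.mul (h.diff_ψ hx a)
  have d12 : ∀ a, DifferentiableAt ℝ (fun z =>
      (pdVec j (pdVec k y) z + (ψ z ⬝ᵥ pdVec j y z) • pdVec k y z) a) x :=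
    fun a => (d1 a).add (d2 a)
  have d123 : ∀ a, DifferentiableAt ℝ (fun z => (pdVec j (pdVec k y) z
      + (ψ z ⬝ᵥ pdVec j y z) • pdVec k y z + (ψ z ⬝ᵥ pdVec k y z) • pdVec j y z) a) x :=
    fun a => (d12 a).add (d3 a)
  unfold push
  rw [pdVec_sub d123 d4, pdVec_add d12 d3, pdVec_add d1 d2,
    pdVec_smul e2 (h.diff_pd hx k), pdVec_smul e3 (h.diff_pd hx j), pdVec_smul e4 (h.diff_ψ hx),
    pd_dotProduct (h.diff_ψ hx) (h.diff_pd hx j), pd_dotProduct (h.diff_ψ hx) (h.diff_pd hx k),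
    pd_dotProduct (h.diff_pd hx j) (h.diff_pd hx k), h.pd_ψ x hx]

/-- Apart from its second-derivative term, `push` depends linearly on ∂ₙy, and contraction with Γⁿⱼₖ
turns ∂ₙy into `push y ψ j k`. The remaining terms Γⁿⱼₖ ∂ᵢ∂ₙy cancel those of
`jac_mulVec_pd_christoffel` in the curvature. -/
theorem sum_christoffel_push (h : ConformalCoords V g y ψ f H) (hx : x ∈ V) (i j k : Fin 5) :
    ∑ n, christoffel g n j k x • push y ψ i n x =
      ∑ n, christoffel g n j k x • pdVec i (pdVec n y) x
        + (ψ x ⬝ᵥ pdVec i y x) • push y ψ j k x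
        + (ψ x ⬝ᵥ push y ψ j k x) • pdVec i y x
        - (pdVec i y x ⬝ᵥ push y ψ j k x) • ψ x := by
  have hK : push y ψ j k x = ∑ n, christoffel g n j k x • pdVec n y x := by
    rw [← h.jac_mulVec_christoffel hx, jac_mulVec_eq_sum]
  simp only [hK, dotProduct_sum, dotProduct_smul, Finset.smul_sum, Finset.sum_smul, smul_smul,
    smul_eq_mul]
  rw [← Finset.sum_add_distrib, ← Finset.sum_add_distrib, ← Finset.sum_sub_distrib]
  refine Finset.sum_congr rfl fun n _ => ?_
  simp only [push, smul_add, smul_sub, smul_smul]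
  rw [mul_comm (ψ x ⬝ᵥ pdVec i y x)]

theorem jac_mulVec_riemann (h : ConformalCoords V g y ψ f H) (hx : x ∈ V) (k i j : Fin 5) :
    jac y x *ᵥ (fun m => riemann g m k i j x) =
      (pdVec i (push y ψ j k) x + (ψ x ⬝ᵥ pdVec i y x) • push y ψ j k x
        + (ψ x ⬝ᵥ push y ψ j k x) • pdVec i y x
        - (pdVec i y x ⬝ᵥ push y ψ j k x) • ψ x)
      - (pdVec j (push y ψ i k) x + (ψ x ⬝ᵥ pdVec j y x) • push y ψ i k x
        + (ψ x ⬝ᵥ push y ψ i k x) • pdVec j y x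
        - (pdVec j y x ⬝ᵥ push y ψ i k x) • ψ x) := by
  have hsplit : (fun m => riemann g m k i j x) =
      (pdVec i (fun z m => christoffel g m j k z) x
        + ∑ n, christoffel g n j k x • fun m => christoffel g m i n x)
      - (pdVec j (fun z m => christoffel g m i k z) x
        + ∑ n, christoffel g n i k x • fun m => christoffel g m j n x) := by
    funext m
    simp only [riemann, Pi.sub_apply, Pi.add_apply, Finset.sum_apply, Pi.smul_apply, smul_eq_mul,
      pdVec, Finset.sum_sub_distrib]
    simp only [mul_comm (christoffel g m _ _ x)]
    ring
  rw [hsplit, Matrix.mulVec_sub, Matrix.mulVec_add, Matrix.mulVec_add, Matrix.mulVec_sum,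
    Matrix.mulVec_sum]
  simp only [Matrix.mulVec_smul, h.jac_mulVec_christoffel hx, h.jac_mulVec_pd_christoffel hx,
    h.sum_christoffel_push hx]
  abel

/-- After pairing with f ∂ₗy, the third derivatives of y drop out by antisymmetry in i, j. The terms
with second derivatives cancel too, and the symmetry of H merges the Hessian terms; what remains is
polynomial in dot products of ψ, ∂y and H∂y. -/
theorem riemann_eq (h : ConformalCoords V g y ψ f H) (hx : x ∈ V) (l k i j : Fin 5) :
    ∑ m, g x l m * riemann g m k i j x =
      g x l i * potential y ψ H x k j - g x l j * potential y ψ H x k i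
        + g x k j * potential y ψ H x l i - g x k i * potential y ψ H x l j := by
  have h1 : ∑ m, g x l m * riemann g m k i j x =
      f x * (pdVec l y x ⬝ᵥ (jac y x *ᵥ fun m => riemann g m k i j x)) := by
    have : ∑ m, g x l m * riemann g m k i j x = (g x *ᵥ fun m => riemann g m k i j x) l := rfl
    rw [this, h.g_eq_mul hx, Matrix.smul_mulVec, ← Matrix.mulVec_mulVec]
    rfl
  have hH : ∀ u v : Fin 5 → ℂ, (H x *ᵥ u) ⬝ᵥ v = (H x *ᵥ v) ⬝ᵥ u := by
    intro u v
    rw [dotProduct_comm, Matrix.dotProduct_mulVec, ← Matrix.mulVec_transpose, (h.symm x hx).eq]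
  rw [h1, h.jac_mulVec_riemann hx, h.pdVec_push hx, h.pdVec_push hx]
  simp only [push, potential, Matrix.of_apply, h.g_eq x hx, dotProduct_add, dotProduct_sub,
    dotProduct_smul, smul_eq_mul]
  rw [h.pdVec_pdVec_comm hx j i k, h.pdVec_comm hx j i,
    hH (pdVec j y x) (pdVec i y x), dotProduct_comm (pdVec l y x) (H x *ᵥ pdVec i y x),
    dotProduct_comm (pdVec l y x) (H x *ᵥ pdVec j y x),
    dotProduct_comm (pdVec j y x) (pdVec i y x),
    dotProduct_comm (pdVec k y x) (pdVec i y x), dotProduct_comm (pdVec k y x) (pdVec j y x),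
    dotProduct_comm (pdVec l y x) (ψ x),
    dotProduct_comm (pdVec i (pdVec j y) x) (pdVec k y x),
    dotProduct_comm (pdVec i y x) (ψ x), dotProduct_comm (pdVec j y x) (ψ x)]
  ring

theorem isSymm_potential (h : ConformalCoords V g y ψ f H) (hx : x ∈ V) :
    (potential y ψ H x).IsSymm := by
  refine Matrix.IsSymm.ext fun i j => ?_
  have : (H x *ᵥ pdVec i y x) ⬝ᵥ pdVec j y x = (H x *ᵥ pdVec j y x) ⬝ᵥ pdVec i y x := by
    rw [dotProduct_comm, Matrix.dotProduct_mulVec, ← Matrix.mulVec_transpose, (h.symm x hx).eq]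
  simp only [potential, Matrix.of_apply, this, dotProduct_comm (pdVec j y x) (pdVec i y x)]
  ring

theorem weyl_eq_zero (h : ConformalCoords V g y ψ f H) (hx : x ∈ V) (l k i j : Fin 5) :
    weyl g l k i j x = 0 :=
  weyl_eq_zero_of_riemann_eq (h.isMetric.symm x hx) (h.isMetric.nondeg x hx) _
    (h.isSymm_potential hx) (h.riemann_eq hx) l k i j

/-- A constant multiple of the metric `∑ₐ (dyᵃ)²` is flat. -/
theorem riemann_eq_zero (h : ConformalCoords V g y 0 f 0) (hx : x ∈ V) (l k i j : Fin 5) :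
    riemann g l k i j x = 0 := by
  have h1 : g x *ᵥ (fun m => riemann g m k i j x) = 0 := by
    funext l
    refine (h.riemann_eq hx l k i j).trans ?_
    simp [potential]
  have h2 := congrArg (fun v => (g x)⁻¹ *ᵥ v) h1
  simp only [Matrix.mulVec_mulVec, Matrix.nonsing_inv_mul _
    (isUnit_iff_ne_zero.mpr (h.isMetric.nondeg x hx)), Matrix.one_mulVec,
    Matrix.mulVec_zero] at h2
  exact congrFun h2 l

end ConformalCoords

/-! ### Derivatives of conjugate and real functions; closedness of differentials. -/

theorem pd_conj {F : Pt → ℂ} {x : Pt} (i : Fin 5) :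
    pd i (fun y => (starRingEnd ℂ) (F y)) x = (starRingEnd ℂ) (pd i F x) := by
  have h := Complex.conjCLE.comp_fderiv (f := F) (x := x)
  have h2 : (Complex.conjCLE ∘ F) = fun y => (starRingEnd ℂ) (F y) := rfl
  unfold pd
  rw [← h2, h]
  rfl

theorem pd_ofReal {F : Pt → ℝ} {x : Pt} (hF : DifferentiableAt ℝ F x) (i : Fin 5) :
    pd i (fun y => (F y : ℂ)) x = ((fderiv ℝ F x (Pi.single i 1) : ℝ) : ℂ) := by
  unfold pd
  have h : HasFDerivAt (fun y => (F y : ℂ)) (Complex.ofRealCLM.comp (fderiv ℝ F x)) x :=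
    Complex.ofRealCLM.hasFDerivAt.comp x hF.hasFDerivAt
  rw [h.fderiv]
  rfl

theorem fderiv_eq_sum {E : Type*} [NormedAddCommGroup E] [NormedSpace ℝ E] (F : Pt → E) (x v : Pt) :
    fderiv ℝ F x v = ∑ i, v i • fderiv ℝ F x (Pi.single i 1) := by
  conv_lhs => rw [pi_eq_sum_univ' v]
  rw [map_sum]
  refine Finset.sum_congr rfl fun i _ => ?_
  rw [map_smul]

theorem extD_apply_of_eq_pd {F : Pt → ℂ} {V : Set Pt} (hV : IsOpen V)
    (hF : ContDiffOn ℝ ∞ F V) {x : Pt} (hx : x ∈ V) : extD (fun y i => pd i F y) x = 0 := by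
  ext i j
  simp only [extD, Matrix.of_apply, Matrix.zero_apply]
  exact sub_eq_zero.mpr (pd_comm hV hF hx i j)

/-! ### The Maurer-Cartan forms in terms of the matrix entries of p. -/

namespace LocalParam

variable (Φ : LocalParam)

/-- The matrix entries of the `SU(2)` component. -/
def entry (a b : Fin 2) (x : Pt) : ℂ := (Φ.p x : Matrix (Fin 2) (Fin 2) ℂ) a b

theorem p_apply (a b : Fin 2) (x : Pt) :
    (Φ.p x : Matrix (Fin 2) (Fin 2) ℂ) a b = Φ.entry a b x := rfl

theorem entry_det (x : Pt) :
    Φ.entry 0 0 x * Φ.entry 1 1 x - Φ.entry 0 1 x * Φ.entry 1 0 x = 1 := by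
  have h := (Matrix.mem_specialUnitaryGroup_iff.mp (Φ.p x).2).2
  rwa [Matrix.det_fin_two] at h

/-- On SU(2) both the conjugate transpose and the adjugate are inverse to p. This removes complex
conjugation from the σₐ, which become polynomial in the entries and their derivatives. -/
theorem conjTranspose_p (x : Pt) : (Φ.p x : Matrix (Fin 2) (Fin 2) ℂ)ᴴ =
    !![Φ.entry 1 1 x, -Φ.entry 0 1 x; -Φ.entry 1 0 x, Φ.entry 0 0 x] := by
  have h := (Matrix.mem_specialUnitaryGroup_iff.mp (Φ.p x).2)
  have h1 : (Φ.p x : Matrix (Fin 2) (Fin 2) ℂ) * (Φ.p x : Matrix (Fin 2) (Fin 2) ℂ)ᴴ = 1 :=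
    Matrix.mem_unitaryGroup_iff.mp h.1
  have h2 : (Φ.p x : Matrix (Fin 2) (Fin 2) ℂ).adjugate * (Φ.p x : Matrix (Fin 2) (Fin 2) ℂ) = 1 := by
    rw [Matrix.adjugate_mul, h.2, one_smul]
  rw [← left_inv_eq_right_inv h2 h1, Matrix.adjugate_fin_two]
  rfl

theorem conj_entry_zero_zero (x : Pt) : (starRingEnd ℂ) (Φ.entry 0 0 x) = Φ.entry 1 1 x :=
  congrFun (congrFun (Φ.conjTranspose_p x) 0) 0

theorem conj_entry_one_zero (x : Pt) : (starRingEnd ℂ) (Φ.entry 1 0 x) = -Φ.entry 0 1 x :=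
  congrFun (congrFun (Φ.conjTranspose_p x) 0) 1

theorem conj_entry_one_one (x : Pt) : (starRingEnd ℂ) (Φ.entry 1 1 x) = Φ.entry 0 0 x :=
  congrFun (congrFun (Φ.conjTranspose_p x) 1) 1

theorem conj_entry_zero_one (x : Pt) : (starRingEnd ℂ) (Φ.entry 0 1 x) = -Φ.entry 1 0 x :=
  congrFun (congrFun (Φ.conjTranspose_p x) 1) 0

theorem contDiffOn_entry (a b : Fin 2) : ContDiffOn ℝ ∞ (Φ.entry a b) Φ.dom := Φ.smooth_p a b

variable {Φ} {x : Pt}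

theorem diff_entry (hx : x ∈ Φ.dom) (a b : Fin 2) : DifferentiableAt ℝ (Φ.entry a b) x :=
  smooth_differentiableAt Φ.isOpen_dom (Φ.contDiffOn_entry a b) hx

theorem pd_entry_det (hx : x ∈ Φ.dom) (i : Fin 5) :
    pd i (Φ.entry 0 0) x * Φ.entry 1 1 x + Φ.entry 0 0 x * pd i (Φ.entry 1 1) x
      - (pd i (Φ.entry 0 1) x * Φ.entry 1 0 x + Φ.entry 0 1 x * pd i (Φ.entry 1 0) x) = 0 := by
  have h := pd_congr Φ.isOpen_dom hx (fun z _ => Φ.entry_det z) i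
  rwa [pd_const, pd_sub (F := fun z => Φ.entry 0 0 z * Φ.entry 1 1 z)
    (G := fun z => Φ.entry 0 1 z * Φ.entry 1 0 z) ((diff_entry hx 0 0).mul (diff_entry hx 1 1))
    ((diff_entry hx 0 1).mul (diff_entry hx 1 0)), pd_mul (diff_entry hx 0 0) (diff_entry hx 1 1),
    pd_mul (diff_entry hx 0 1) (diff_entry hx 1 0)] at h

theorem sigma_zero (x : Pt) (i : Fin 5) : Φ.sigma 0 x i = -Complex.I *
    (Φ.entry 1 1 x * pd i (Φ.entry 0 1) x - Φ.entry 0 1 x * pd i (Φ.entry 1 1) x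
      + (Φ.entry 0 0 x * pd i (Φ.entry 1 0) x - Φ.entry 1 0 x * pd i (Φ.entry 0 0) x)) := by
  simp only [sigma, conjTranspose_p, Matrix.trace_fin_two, Matrix.mul_apply, Fin.sum_univ_two,
    Matrix.conjTranspose_apply, su2Basis, dp, Matrix.of_apply, p_apply]
  simp
  ring_nf

theorem sigma_one (x : Pt) (i : Fin 5) : Φ.sigma 1 x i =
    (Φ.entry 1 1 x * pd i (Φ.entry 0 1) x - Φ.entry 0 1 x * pd i (Φ.entry 1 1) x)
      - (Φ.entry 0 0 x * pd i (Φ.entry 1 0) x - Φ.entry 1 0 x * pd i (Φ.entry 0 0) x) := by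
  simp only [sigma, conjTranspose_p, Matrix.trace_fin_two, Matrix.mul_apply, Fin.sum_univ_two,
    Matrix.conjTranspose_apply, su2Basis, dp, Matrix.of_apply, p_apply]
  simp
  ring_nf
  simp
  ring_nf

theorem sigma_two (x : Pt) (i : Fin 5) : Φ.sigma 2 x i = -Complex.I *
    ((Φ.entry 1 1 x * pd i (Φ.entry 0 0) x - Φ.entry 0 1 x * pd i (Φ.entry 1 0) x)
      - (Φ.entry 0 0 x * pd i (Φ.entry 1 1) x - Φ.entry 1 0 x * pd i (Φ.entry 0 1) x)) := by
  simp only [sigma, conjTranspose_p, Matrix.trace_fin_two, Matrix.mul_apply, Fin.sum_univ_two,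
    Matrix.conjTranspose_apply, su2Basis, dp, Matrix.of_apply, p_apply]
  simp
  ring_nf

/-! The equation `dp = p ∑ₐ σₐ ξₐ`, entry by entry. -/

theorem pd_entry_zero (hx : x ∈ Φ.dom) (i : Fin 5) (a : Fin 2) : pd i (Φ.entry a 0) x =
    (Complex.I / 2) * (Φ.entry a 0 x * Φ.sigma 2 x i
      + Φ.entry a 1 x * (Φ.sigma 0 x i + Complex.I * Φ.sigma 1 x i)) := by
  have h1 := Φ.entry_det x
  -- The traces defining σₐ only see the traceless part of p⁻¹dp. The derivative of det p = 1 says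
  -- that this is all of it.
  have h2 := pd_entry_det hx i
  rw [sigma_zero, sigma_one, sigma_two]
  fin_cases a <;> simp only [Fin.zero_eta, Fin.mk_one, Fin.isValue]
  · linear_combination (-pd i (Φ.entry 0 0) x) * h1 + Φ.entry 0 0 x / 2 * h2
      + (Φ.entry 0 0 x * ((Φ.entry 1 1 x * pd i (Φ.entry 0 0) x - Φ.entry 0 1 x * pd i (Φ.entry 1 0) x)
        - (Φ.entry 0 0 x * pd i (Φ.entry 1 1) x - Φ.entry 1 0 x * pd i (Φ.entry 0 1) x)) / 2
        + Φ.entry 0 1 x * (Φ.entry 0 0 x * pd i (Φ.entry 1 0) x - Φ.entry 1 0 x * pd i (Φ.entry 0 0) x)) * Complex.I_sq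
  · linear_combination (-pd i (Φ.entry 1 0) x) * h1 + Φ.entry 1 0 x / 2 * h2
      + (Φ.entry 1 0 x * ((Φ.entry 1 1 x * pd i (Φ.entry 0 0) x - Φ.entry 0 1 x * pd i (Φ.entry 1 0) x)
        - (Φ.entry 0 0 x * pd i (Φ.entry 1 1) x - Φ.entry 1 0 x * pd i (Φ.entry 0 1) x)) / 2
        + Φ.entry 1 1 x * (Φ.entry 0 0 x * pd i (Φ.entry 1 0) x - Φ.entry 1 0 x * pd i (Φ.entry 0 0) x)) * Complex.I_sq

theorem pd_entry_one (hx : x ∈ Φ.dom) (i : Fin 5) (a : Fin 2) : pd i (Φ.entry a 1) x =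
    (Complex.I / 2) * (Φ.entry a 0 x * (Φ.sigma 0 x i - Complex.I * Φ.sigma 1 x i)
      - Φ.entry a 1 x * Φ.sigma 2 x i) := by
  have h1 := Φ.entry_det x
  have h2 := pd_entry_det hx i
  rw [sigma_zero, sigma_one, sigma_two]
  fin_cases a <;> simp only [Fin.zero_eta, Fin.mk_one, Fin.isValue]
  · linear_combination (-pd i (Φ.entry 0 1) x) * h1 + Φ.entry 0 1 x / 2 * h2
      + (Φ.entry 0 0 x * (Φ.entry 1 1 x * pd i (Φ.entry 0 1) x - Φ.entry 0 1 x * pd i (Φ.entry 1 1) x)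
        - Φ.entry 0 1 x * ((Φ.entry 1 1 x * pd i (Φ.entry 0 0) x - Φ.entry 0 1 x * pd i (Φ.entry 1 0) x)
        - (Φ.entry 0 0 x * pd i (Φ.entry 1 1) x - Φ.entry 1 0 x * pd i (Φ.entry 0 1) x)) / 2) * Complex.I_sq
  · linear_combination (-pd i (Φ.entry 1 1) x) * h1 + Φ.entry 1 1 x / 2 * h2
      + (Φ.entry 1 0 x * (Φ.entry 1 1 x * pd i (Φ.entry 0 1) x - Φ.entry 0 1 x * pd i (Φ.entry 1 1) x)
        - Φ.entry 1 1 x * ((Φ.entry 1 1 x * pd i (Φ.entry 0 0) x - Φ.entry 0 1 x * pd i (Φ.entry 1 0) x)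
        - (Φ.entry 0 0 x * pd i (Φ.entry 1 1) x - Φ.entry 1 0 x * pd i (Φ.entry 0 1) x)) / 2) * Complex.I_sq

end LocalParam

/-! ### The exterior derivative -/

/-- The differential of a function. -/
def diffForm (F : Pt → ℂ) : OneForm := fun x i => pd i F x

section ExtD

variable {V : Set Pt} {v w : OneForm} {F : Pt → ℂ} {x : Pt}

theorem SmoothForm.add (hv : SmoothForm V v) (hw : SmoothForm V w) :
    SmoothForm V (fun x => v x + w x) := fun i => (hv i).add (hw i)

theorem SmoothForm.sub (hv : SmoothForm V v) (hw : SmoothForm V w) :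
    SmoothForm V (fun x => v x - w x) := fun i => (hv i).sub (hw i)

theorem SmoothForm.smul (hF : ContDiffOn ℝ ∞ F V) (hw : SmoothForm V w) :
    SmoothForm V (fun x => F x • w x) := fun i => hF.mul (hw i)

theorem SmoothForm.const_smul (c : ℂ) (hw : SmoothForm V w) :
    SmoothForm V (fun x => c • w x) := fun i => contDiffOn_const.mul (hw i)

theorem smoothForm_zero : SmoothForm V 0 := fun _ => contDiffOn_const

theorem smoothForm_diffForm (hV : IsOpen V) (hF : ContDiffOn ℝ ∞ F V) :
    SmoothForm V (diffForm F) := fun i => contDiffOn_pd hV hF i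

theorem extD_add (hV : IsOpen V) (hv : SmoothForm V v) (hw : SmoothForm V w) (hx : x ∈ V) :
    extD (fun y => v y + w y) x = extD v x + extD w x := by
  have h1 := fun i => smooth_differentiableAt hV (hv i) hx
  have h2 := fun i => smooth_differentiableAt hV (hw i) hx
  ext i j
  simp only [extD, Matrix.of_apply, Matrix.add_apply, Pi.add_apply, pd_add (h1 _) (h2 _)]
  ring

theorem extD_sub (hV : IsOpen V) (hv : SmoothForm V v) (hw : SmoothForm V w) (hx : x ∈ V) :
    extD (fun y => v y - w y) x = extD v x - extD w x := by
  have h1 := fun i => smooth_differentiableAt hV (hv i) hx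
  have h2 := fun i => smooth_differentiableAt hV (hw i) hx
  ext i j
  simp only [extD, Matrix.of_apply, Matrix.sub_apply, Pi.sub_apply, pd_sub (h1 _) (h2 _)]
  ring

theorem extD_smul (hV : IsOpen V) (hF : ContDiffOn ℝ ∞ F V) (hw : SmoothForm V w) (hx : x ∈ V) :
    extD (fun y => F y • w y) x = wedge (diffForm F x) (w x) + F x • extD w x := by
  have h1 := smooth_differentiableAt hV hF hx
  have h2 := fun i => smooth_differentiableAt hV (hw i) hx
  ext i j
  simp only [extD, Matrix.of_apply, Matrix.add_apply, Pi.smul_apply, smul_eq_mul,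
    Matrix.smul_apply, pd_mul h1 (h2 _), wedge, diffForm]
  ring

theorem extD_const_smul (hV : IsOpen V) (c : ℂ) (hw : SmoothForm V w) (hx : x ∈ V) :
    extD (fun y => c • w y) x = c • extD w x := by
  have h2 := fun i => smooth_differentiableAt hV (hw i) hx
  ext i j
  simp only [extD, Matrix.of_apply, Pi.smul_apply, smul_eq_mul, Matrix.smul_apply,
    pd_const_mul c (h2 _)]
  ring

theorem extD_diffForm (hV : IsOpen V) (hF : ContDiffOn ℝ ∞ F V) (hx : x ∈ V) :
    extD (diffForm F) x = 0 := extD_apply_of_eq_pd hV hF hx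

end ExtD

/-! ### Structure equations, reality and independence of σ₁, σ₂, σ₃, dr, du. -/

namespace LocalParam

variable {Φ : LocalParam} {x : Pt}

theorem smooth_diff_entry (a b : Fin 2) : SmoothForm Φ.dom (diffForm (Φ.entry a b)) :=
  smoothForm_diffForm Φ.isOpen_dom (Φ.contDiffOn_entry a b)

theorem smooth_entry_smul (a b c d : Fin 2) :
    SmoothForm Φ.dom (fun x => Φ.entry a b x • diffForm (Φ.entry c d) x) :=
  SmoothForm.smul (Φ.contDiffOn_entry a b) (smooth_diff_entry c d)

theorem extD_entry_smul (hx : x ∈ Φ.dom) (a b c d : Fin 2) :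
    extD (fun x => Φ.entry a b x • diffForm (Φ.entry c d) x) x =
      wedge (diffForm (Φ.entry a b) x) (diffForm (Φ.entry c d) x) := by
  rw [extD_smul Φ.isOpen_dom (Φ.contDiffOn_entry a b) (smooth_diff_entry c d) hx,
    extD_diffForm Φ.isOpen_dom (Φ.contDiffOn_entry c d) hx, smul_zero, add_zero]

theorem sigma_zero_eq : Φ.sigma 0 = fun x => -Complex.I •
    ((Φ.entry 1 1 x • diffForm (Φ.entry 0 1) x - Φ.entry 0 1 x • diffForm (Φ.entry 1 1) x)
      + (Φ.entry 0 0 x • diffForm (Φ.entry 1 0) x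
        - Φ.entry 1 0 x • diffForm (Φ.entry 0 0) x)) :=
  funext fun x => funext fun i => sigma_zero x i

theorem sigma_one_eq : Φ.sigma 1 = fun x =>
    (Φ.entry 1 1 x • diffForm (Φ.entry 0 1) x - Φ.entry 0 1 x • diffForm (Φ.entry 1 1) x)
      - (Φ.entry 0 0 x • diffForm (Φ.entry 1 0) x
        - Φ.entry 1 0 x • diffForm (Φ.entry 0 0) x) :=
  funext fun x => funext fun i => sigma_one x i

theorem sigma_two_eq : Φ.sigma 2 = fun x => -Complex.I •
    ((Φ.entry 1 1 x • diffForm (Φ.entry 0 0) x - Φ.entry 0 1 x • diffForm (Φ.entry 1 0) x)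
      - (Φ.entry 0 0 x • diffForm (Φ.entry 1 1) x
        - Φ.entry 1 0 x • diffForm (Φ.entry 0 1) x)) :=
  funext fun x => funext fun i => sigma_two x i

theorem smooth_entry_smul_sub (a b c d a' b' c' d' : Fin 2) :
    SmoothForm Φ.dom (fun x => Φ.entry a b x • diffForm (Φ.entry c d) x
      - Φ.entry a' b' x • diffForm (Φ.entry c' d') x) :=
  SmoothForm.sub (smooth_entry_smul a b c d) (smooth_entry_smul a' b' c' d')

theorem smooth_sigma (a : Fin 3) : SmoothForm Φ.dom (Φ.sigma a) := by
  fin_cases a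
  · exact sigma_zero_eq ▸ SmoothForm.const_smul _
      (SmoothForm.add (smooth_entry_smul_sub _ _ _ _ _ _ _ _)
        (smooth_entry_smul_sub _ _ _ _ _ _ _ _))
  · exact sigma_one_eq ▸ SmoothForm.sub (smooth_entry_smul_sub _ _ _ _ _ _ _ _)
      (smooth_entry_smul_sub _ _ _ _ _ _ _ _)
  · exact sigma_two_eq ▸ SmoothForm.const_smul _
      (SmoothForm.sub (smooth_entry_smul_sub _ _ _ _ _ _ _ _)
        (smooth_entry_smul_sub _ _ _ _ _ _ _ _))

/-! The structure equations of `SU(2)`. -/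

theorem extD_sigma_zero (hx : x ∈ Φ.dom) :
    extD (Φ.sigma 0) x = wedge (Φ.sigma 1 x) (Φ.sigma 2 x) := by
  have hV := Φ.isOpen_dom
  have hs := fun a b c d => smooth_entry_smul (Φ := Φ) a b c d
  have hd := fun a b c d a' b' c' d' => smooth_entry_smul_sub (Φ := Φ) a b c d a' b' c' d'
  conv_lhs => rw [sigma_zero_eq]
  rw [extD_const_smul hV _ (SmoothForm.add (hd _ _ _ _ _ _ _ _) (hd _ _ _ _ _ _ _ _)) hx,
    extD_add hV (hd _ _ _ _ _ _ _ _) (hd _ _ _ _ _ _ _ _) hx,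
    extD_sub hV (hs _ _ _ _) (hs _ _ _ _) hx, extD_sub hV (hs _ _ _ _) (hs _ _ _ _) hx]
  -- By d² = 0 only wedges of differentials of entries remain. Substituting dp = p ∑ σₐξₐ and det p
  -- = 1 leaves the bracket relation of su(2).
  simp only [extD_entry_smul hx]
  ext i j
  simp only [wedge, diffForm, Matrix.of_apply, Matrix.add_apply, Matrix.sub_apply,
    Matrix.smul_apply, smul_eq_mul, pd_entry_zero hx, pd_entry_one hx]
  have h := Φ.entry_det x
  generalize Φ.sigma 0 x = s0
  generalize Φ.sigma 1 x = s1
  generalize Φ.sigma 2 x = s2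
  have hI : Complex.I ^ 4 = 1 := Complex.I_pow_four
  linear_combination (s1 i * s2 j - s1 j * s2 i) * (Complex.I ^ 4 * h + hI)

theorem extD_sigma_one (hx : x ∈ Φ.dom) :
    extD (Φ.sigma 1) x = wedge (Φ.sigma 2 x) (Φ.sigma 0 x) := by
  have hV := Φ.isOpen_dom
  have hs := fun a b c d => smooth_entry_smul (Φ := Φ) a b c d
  have hd := fun a b c d a' b' c' d' => smooth_entry_smul_sub (Φ := Φ) a b c d a' b' c' d'
  conv_lhs => rw [sigma_one_eq]
  rw [extD_sub hV (hd _ _ _ _ _ _ _ _) (hd _ _ _ _ _ _ _ _) hx,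
    extD_sub hV (hs _ _ _ _) (hs _ _ _ _) hx, extD_sub hV (hs _ _ _ _) (hs _ _ _ _) hx]
  simp only [extD_entry_smul hx]
  ext i j
  simp only [wedge, diffForm, Matrix.of_apply, Matrix.sub_apply,
    pd_entry_zero hx, pd_entry_one hx]
  have h := Φ.entry_det x
  generalize Φ.sigma 0 x = s0
  generalize Φ.sigma 1 x = s1
  generalize Φ.sigma 2 x = s2
  linear_combination (s2 i * s0 j - s2 j * s0 i) * (-Complex.I ^ 2 * h - Complex.I_sq)

theorem extD_sigma_two (hx : x ∈ Φ.dom) :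
    extD (Φ.sigma 2) x = wedge (Φ.sigma 0 x) (Φ.sigma 1 x) := by
  have hV := Φ.isOpen_dom
  have hs := fun a b c d => smooth_entry_smul (Φ := Φ) a b c d
  have hd := fun a b c d a' b' c' d' => smooth_entry_smul_sub (Φ := Φ) a b c d a' b' c' d'
  conv_lhs => rw [sigma_two_eq]
  rw [extD_const_smul hV _ (SmoothForm.sub (hd _ _ _ _ _ _ _ _) (hd _ _ _ _ _ _ _ _)) hx,
    extD_sub hV (hd _ _ _ _ _ _ _ _) (hd _ _ _ _ _ _ _ _) hx,
    extD_sub hV (hs _ _ _ _) (hs _ _ _ _) hx, extD_sub hV (hs _ _ _ _) (hs _ _ _ _) hx]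
  simp only [extD_entry_smul hx]
  ext i j
  simp only [wedge, diffForm, Matrix.of_apply, Matrix.sub_apply,
    Matrix.smul_apply, smul_eq_mul, pd_entry_zero hx, pd_entry_one hx]
  have h := Φ.entry_det x
  generalize Φ.sigma 0 x = s0
  generalize Φ.sigma 1 x = s1
  generalize Φ.sigma 2 x = s2
  have hI : Complex.I ^ 4 = 1 := Complex.I_pow_four
  linear_combination (s0 i * s1 j - s0 j * s1 i) * (Complex.I ^ 4 * h + hI)

/-! The forms `dr` and `du`. -/

theorem contDiffOn_r : ContDiffOn ℝ ∞ (fun y => (Φ.r y : ℂ)) Φ.dom :=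
  Complex.ofRealCLM.contDiff.comp_contDiffOn Φ.smooth_r

theorem contDiffOn_u : ContDiffOn ℝ ∞ (fun y => (Φ.u y : ℂ)) Φ.dom :=
  Complex.ofRealCLM.contDiff.comp_contDiffOn Φ.smooth_u

theorem smooth_dr : SmoothForm Φ.dom Φ.dr := smoothForm_diffForm Φ.isOpen_dom contDiffOn_r

theorem smooth_du : SmoothForm Φ.dom Φ.du := smoothForm_diffForm Φ.isOpen_dom contDiffOn_u

theorem extD_dr (hx : x ∈ Φ.dom) : extD Φ.dr x = 0 := extD_diffForm Φ.isOpen_dom contDiffOn_r hx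

theorem extD_du (hx : x ∈ Φ.dom) : extD Φ.du x = 0 := extD_diffForm Φ.isOpen_dom contDiffOn_u hx

theorem dr_apply (hx : x ∈ Φ.dom) (i : Fin 5) :
    Φ.dr x i = ((fderiv ℝ Φ.r x (Pi.single i 1) : ℝ) : ℂ) :=
  pd_ofReal ((Φ.smooth_r.contDiffAt (Φ.isOpen_dom.mem_nhds hx)).differentiableAt (by simp)) i

theorem du_apply (hx : x ∈ Φ.dom) (i : Fin 5) :
    Φ.du x i = ((fderiv ℝ Φ.u x (Pi.single i 1) : ℝ) : ℂ) :=
  pd_ofReal ((Φ.smooth_u.contDiffAt (Φ.isOpen_dom.mem_nhds hx)).differentiableAt (by simp)) i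

/-! The five 1-forms `σ₁, σ₂, σ₃, dr, du` are real, and independent. -/

theorem conj_pd_entry {a b c d : Fin 2} {s : ℂ}
    (h : ∀ y, (starRingEnd ℂ) (Φ.entry a b y) = s * Φ.entry c d y) (hx : x ∈ Φ.dom) (i : Fin 5) :
    (starRingEnd ℂ) (pd i (Φ.entry a b) x) = s * pd i (Φ.entry c d) x := by
  rw [← pd_conj, ← pd_const_mul s (diff_entry hx c d)]
  exact pd_congr Φ.isOpen_dom hx (fun y _ => h y) i

theorem conj_sigma (hx : x ∈ Φ.dom) (a : Fin 3) (i : Fin 5) :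
    (starRingEnd ℂ) (Φ.sigma a x i) = Φ.sigma a x i := by
  have h00 := conj_pd_entry (s := 1) (fun y => by rw [Φ.conj_entry_zero_zero y, one_mul]) hx i
  have h11 := conj_pd_entry (s := 1) (fun y => by rw [Φ.conj_entry_one_one y, one_mul]) hx i
  have h01 := conj_pd_entry (s := -1) (fun y => by rw [Φ.conj_entry_zero_one y, neg_one_mul]) hx i
  have h10 := conj_pd_entry (s := -1) (fun y => by rw [Φ.conj_entry_one_zero y, neg_one_mul]) hx i
  fin_cases a <;> simp only [Fin.zero_eta, Fin.mk_one, Fin.reduceFinMk, Fin.isValue]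
  · rw [sigma_zero]
    simp only [map_mul, map_neg, map_add, map_sub, Complex.conj_I, h00, h01, h10, h11,
      conj_entry_zero_zero, conj_entry_zero_one, conj_entry_one_zero, conj_entry_one_one]
    ring
  · rw [sigma_one]
    simp only [map_mul, map_sub, h00, h01, h10, h11,
      conj_entry_zero_zero, conj_entry_zero_one, conj_entry_one_zero, conj_entry_one_one]
    ring
  · rw [sigma_two]
    simp only [map_mul, map_neg, map_sub, Complex.conj_I, h00, h01, h10, h11,
      conj_entry_zero_zero, conj_entry_zero_one, conj_entry_one_zero, conj_entry_one_one]
    ring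

theorem conj_coframe (hx : x ∈ Φ.dom) (A i : Fin 5) :
    (starRingEnd ℂ) (Φ.coframe x A i) = Φ.coframe x A i := by
  fin_cases A
  · exact conj_sigma hx 0 i
  · exact conj_sigma hx 1 i
  · exact conj_sigma hx 2 i
  · change (starRingEnd ℂ) (Φ.dr x i) = Φ.dr x i
    rw [dr_apply hx, Complex.conj_ofReal]
  · change (starRingEnd ℂ) (Φ.du x i) = Φ.du x i
    rw [du_apply hx, Complex.conj_ofReal]

/-- The immersion hypothesis concerns real tangent vectors only. All five forms are real, so a
degenerate coframe would have a real kernel vector v; such a v is annihilated by dp, dr and du,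
contrary to immersion. -/
theorem det_coframe_ne_zero (hx : x ∈ Φ.dom) : (Φ.coframe x).det ≠ 0 := by
  set R : Matrix (Fin 5) (Fin 5) ℝ := Matrix.of fun A i => (Φ.coframe x A i).re with hR
  have hC : Φ.coframe x = (Complex.ofRealHom : ℝ →+* ℂ).mapMatrix R := by
    ext A i
    exact (Complex.conj_eq_iff_re.mp (conj_coframe hx A i)).symm
  rw [hC, ← RingHom.map_det]
  intro h
  have h0 : R.det = 0 := Complex.ofReal_eq_zero.mp h
  obtain ⟨v, hv, hRv⟩ := Matrix.exists_mulVec_eq_zero_iff.mpr h0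
  refine hv ?_
  have hCv : ∀ A, ∑ i, (v i : ℂ) * Φ.coframe x A i = 0 := by
    intro A
    have h1 := congrArg Complex.ofReal (congrFun hRv A)
    simp only [Matrix.mulVec, dotProduct, Complex.ofReal_sum, Complex.ofReal_mul,
      Pi.zero_apply, Complex.ofReal_zero] at h1
    rw [← h1]
    refine Finset.sum_congr rfl fun i _ => ?_
    rw [hC, mul_comm]
    rfl
  have hs0 : ∑ i, (v i : ℂ) * Φ.sigma 0 x i = 0 := hCv 0
  have hs1 : ∑ i, (v i : ℂ) * Φ.sigma 1 x i = 0 := hCv 1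
  have hs2 : ∑ i, (v i : ℂ) * Φ.sigma 2 x i = 0 := hCv 2
  have hr : ∑ i, (v i : ℂ) * Φ.dr x i = 0 := hCv 3
  have hu : ∑ i, (v i : ℂ) * Φ.du x i = 0 := hCv 4
  refine Φ.immersion x hx v ?_ ?_ ?_
  -- Here dp(v) = p ∑ σₐ(v) ξₐ = 0.
  · intro a b
    rw [fderiv_eq_sum]
    simp only [Complex.real_smul]
    change ∑ i, (v i : ℂ) * pd i (Φ.entry a b) x = 0
    fin_cases b <;> simp only [Fin.zero_eta, Fin.mk_one, Fin.isValue]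
    · have : ∑ i, (v i : ℂ) * pd i (Φ.entry a 0) x =
          (Complex.I / 2) * (Φ.entry a 0 x * ∑ i, (v i : ℂ) * Φ.sigma 2 x i
            + Φ.entry a 1 x * (∑ i, (v i : ℂ) * Φ.sigma 0 x i
              + Complex.I * ∑ i, (v i : ℂ) * Φ.sigma 1 x i)) := by
        simp only [Finset.mul_sum, ← Finset.sum_add_distrib]
        refine Finset.sum_congr rfl fun i _ => ?_
        rw [pd_entry_zero hx]
        ring
      rw [this, hs0, hs1, hs2]
      ring
    · have : ∑ i, (v i : ℂ) * pd i (Φ.entry a 1) x =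
          (Complex.I / 2) * (Φ.entry a 0 x * (∑ i, (v i : ℂ) * Φ.sigma 0 x i
              - Complex.I * ∑ i, (v i : ℂ) * Φ.sigma 1 x i)
            - Φ.entry a 1 x * ∑ i, (v i : ℂ) * Φ.sigma 2 x i) := by
        simp only [Finset.mul_sum, ← Finset.sum_sub_distrib]
        refine Finset.sum_congr rfl fun i _ => ?_
        rw [pd_entry_one hx]
        ring
      rw [this, hs0, hs1, hs2]
      ring
  · rw [fderiv_eq_sum]
    refine Complex.ofReal_injective ?_
    simp only [smul_eq_mul, Complex.ofReal_sum, Complex.ofReal_mul, ← dr_apply hx,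
      Complex.ofReal_zero]
    exact hr
  · rw [fderiv_eq_sum]
    refine Complex.ofReal_injective ?_
    simp only [smul_eq_mul, Complex.ofReal_sum, Complex.ofReal_mul, ← du_apply hx,
      Complex.ofReal_zero]
    exact hu

end LocalParam

/-! ### The phase factor and its derivative. -/

namespace LocalParam

variable {Φ : LocalParam} {x : Pt} {ε : ℂ}

theorem sqrtTwo_ne_zero : sqrtTwo ≠ 0 := by
  simp [sqrtTwo]

theorem sqrtTwo_sq : sqrtTwo ^ 2 = 2 := by
  rw [sqrtTwo, ← Complex.ofReal_pow, Real.sq_sqrt (by norm_num)]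
  norm_num

theorem phase_ne_zero : Φ.phase ε x ≠ 0 := Complex.exp_ne_zero _

theorem phase_neg_mul : Φ.phase (-ε) x * Φ.phase ε x = 1 := by
  rw [phase, phase, ← Complex.exp_add]
  convert Complex.exp_zero using 2
  ring

theorem contDiffOn_phase : ContDiffOn ℝ ∞ (Φ.phase ε) Φ.dom :=
  (contDiffOn_const.mul contDiffOn_r).cexp

theorem pd_phase (hx : x ∈ Φ.dom) (i : Fin 5) :
    pd i (Φ.phase ε) x = (ε * (Complex.I / 3)) * Φ.phase ε x * Φ.dr x i := by
  have h := smooth_differentiableAt Φ.isOpen_dom contDiffOn_r hx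
  unfold phase
  rw [pd_exp (h.const_mul _), pd_const_mul _ h]
  simp only [dr]
  ring

/-! ### A coframe with constant structure functions -/

/-- The 1-form `(3 / (2√2)) e^{∓ i r / 3} du`. -/
def nu (Φ : LocalParam) (ε : ℂ) : OneForm := fun x =>
  ((3 / (2 * sqrtTwo)) * Φ.phase (-ε) x) • Φ.du x

theorem contDiffOn_nu_coeff :
    ContDiffOn ℝ ∞ (fun x => (3 / (2 * sqrtTwo)) * Φ.phase (-ε) x) Φ.dom :=
  contDiffOn_const.mul contDiffOn_phase

theorem smooth_nu : SmoothForm Φ.dom (Φ.nu ε) := SmoothForm.smul contDiffOn_nu_coeff smooth_du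

/-- As du is closed, only the phase is differentiated, and its logarithmic derivative is a constant
multiple of dr. This is what makes the structure functions constant. -/
theorem extD_nu (hx : x ∈ Φ.dom) :
    extD (Φ.nu ε) x = (-(ε * (Complex.I / 3))) • wedge (Φ.dr x) (Φ.nu ε x) := by
  unfold nu
  rw [extD_smul Φ.isOpen_dom contDiffOn_nu_coeff smooth_du hx, extD_du hx]
  have h : diffForm (fun x => (3 / (2 * sqrtTwo)) * Φ.phase (-ε) x) x =
      (-(ε * (Complex.I / 3)) * ((3 / (2 * sqrtTwo)) * Φ.phase (-ε) x)) • Φ.dr x := by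
    funext i
    simp only [diffForm, Pi.smul_apply, smul_eq_mul]
    rw [pd_const_mul _ (smooth_differentiableAt Φ.isOpen_dom contDiffOn_phase hx), pd_phase hx]
    ring
  rw [h]
  ext i j
  simp only [wedge, Matrix.add_apply, Matrix.smul_apply, Matrix.of_apply, Matrix.zero_apply,
    Pi.smul_apply, smul_eq_mul]
  ring

/-- The matrix with rows `σ₁, σ₂, σ₃, dr, ν`. -/
def lieCoframe (Φ : LocalParam) (ε : ℂ) (x : Pt) : Matrix (Fin 5) (Fin 5) ℂ :=
  Matrix.of ![Φ.sigma 0 x, Φ.sigma 1 x, Φ.sigma 2 x, Φ.dr x, Φ.nu ε x]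

theorem lieCoframe_eq : Φ.lieCoframe ε x =
    Matrix.diagonal ![1, 1, 1, 1, (3 / (2 * sqrtTwo)) * Φ.phase (-ε) x] * Φ.coframe x := by
  ext A i
  rw [Matrix.diagonal_mul]
  fin_cases A <;> simp [lieCoframe, coframe, nu]

theorem isUnit_lieCoframe (hx : x ∈ Φ.dom) : IsUnit (Φ.lieCoframe ε x) := by
  rw [Matrix.isUnit_iff_isUnit_det, isUnit_iff_ne_zero, lieCoframe_eq, Matrix.det_mul,
    Matrix.det_diagonal]
  refine mul_ne_zero ?_ (det_coframe_ne_zero hx)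
  simp [Fin.prod_univ_five, sqrtTwo_ne_zero, phase_ne_zero]

/-- The 1-form with constant coefficients with respect to `σ₁, σ₂, σ₃, dr, ν`. -/
def lieForm (Φ : LocalParam) (ε : ℂ) (c : Fin 5 → ℂ) : OneForm := fun x =>
  c ᵥ* Φ.lieCoframe ε x

theorem lieForm_eq (c : Fin 5 → ℂ) : Φ.lieForm ε c = fun x =>
    c 0 • Φ.sigma 0 x + c 1 • Φ.sigma 1 x + c 2 • Φ.sigma 2 x + c 3 • Φ.dr x
      + c 4 • Φ.nu ε x := by
  funext x i
  simp only [lieForm, Matrix.vecMul, dotProduct, Fin.sum_univ_five]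
  rfl

theorem lieForm_apply (c : Fin 5 → ℂ) (x : Pt) (i : Fin 5) : Φ.lieForm ε c x i =
    c 0 * Φ.sigma 0 x i + c 1 * Φ.sigma 1 x i + c 2 * Φ.sigma 2 x i + c 3 * Φ.dr x i
      + c 4 * Φ.nu ε x i := by
  rw [lieForm_eq]
  rfl

theorem smooth_lieForm (c : Fin 5 → ℂ) : SmoothForm Φ.dom (Φ.lieForm ε c) := by
  rw [lieForm_eq]
  exact ((((smooth_sigma 0).const_smul _).add ((smooth_sigma 1).const_smul _)).add
    ((smooth_sigma 2).const_smul _)).add (smooth_dr.const_smul _) |>.add (smooth_nu.const_smul _)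

theorem extD_lieForm (hx : x ∈ Φ.dom) (c : Fin 5 → ℂ) : extD (Φ.lieForm ε c) x =
    c 0 • wedge (Φ.sigma 1 x) (Φ.sigma 2 x) + c 1 • wedge (Φ.sigma 2 x) (Φ.sigma 0 x)
      + c 2 • wedge (Φ.sigma 0 x) (Φ.sigma 1 x)
      - (c 4 * (ε * (Complex.I / 3))) • wedge (Φ.dr x) (Φ.nu ε x) := by
  have hV := Φ.isOpen_dom
  have h0 := (smooth_sigma (Φ := Φ) 0).const_smul (c 0)
  have h1 := (smooth_sigma (Φ := Φ) 1).const_smul (c 1)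
  have h2 := (smooth_sigma (Φ := Φ) 2).const_smul (c 2)
  have h3 := (smooth_dr (Φ := Φ)).const_smul (c 3)
  have h4 := (smooth_nu (Φ := Φ) (ε := ε)).const_smul (c 4)
  rw [lieForm_eq, extD_add hV (((h0.add h1).add h2).add h3) h4 hx,
    extD_add hV ((h0.add h1).add h2) h3 hx, extD_add hV (h0.add h1) h2 hx, extD_add hV h0 h1 hx,
    extD_const_smul hV _ (smooth_sigma 0) hx, extD_const_smul hV _ (smooth_sigma 1) hx,
    extD_const_smul hV _ (smooth_sigma 2) hx, extD_const_smul hV _ smooth_dr hx,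
    extD_const_smul hV _ smooth_nu hx, extD_sigma_zero hx, extD_sigma_one hx, extD_sigma_two hx,
    extD_dr hx, extD_nu hx, smul_zero, add_zero, smul_smul, sub_eq_add_neg, ← neg_smul, mul_neg]

theorem omega1_eq : Φ.omega1 ε = Φ.lieForm ε ![1, 0, 0, 0, 1] := by
  funext x i
  simp [lieForm_apply, omega1, nu]

theorem omega2_eq : Φ.omega2 = Φ.lieForm ε ![0, 1, 0, 1, 0] := by
  funext x i
  simp [lieForm_apply, omega2]

theorem omega3_eq : Φ.omega3 ε = Φ.lieForm ε ![0, 0, 1, 0, ε * (Complex.I / 3)] := by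
  funext x i
  simp [lieForm_apply, omega3, nu]
  ring

theorem omega4_eq : Φ.omega4 = Φ.lieForm ε ![0, 0, 0, 1, 0] := by
  funext x i
  simp [lieForm_apply, omega4]

theorem omega5_eq : Φ.omega5 ε = Φ.lieForm ε ![0, 0, 0, 0, -1] := by
  funext x i
  simp [lieForm_apply, omega5, nu]

theorem omegaBar1_eq : Φ.omegaBar1 ε = Φ.lieForm ε ![1, 0, 0, 0, -1] := by
  funext x i
  simp [lieForm_apply, omegaBar1, omega5, nu]

theorem omegaBar2_eq : Φ.omegaBar2 = Φ.lieForm ε ![0, 1, 0, -1, 0] := by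
  funext x i
  simp [lieForm_apply, omegaBar2, omega4]
  ring

/-! ### Annihilators -/

theorem coframe_mulVec_frame (hx : x ∈ Φ.dom) (b : Fin 5) :
    Φ.coframe x *ᵥ Φ.frame b x = Pi.single b 1 := by
  have h : Φ.frame b x = (Φ.coframe x)⁻¹ *ᵥ Pi.single b 1 := by
    rw [Matrix.mulVec_single_one]
    rfl
  rw [h, Matrix.mulVec_mulVec, Matrix.mul_nonsing_inv _
    (isUnit_iff_ne_zero.mpr (det_coframe_ne_zero hx)), Matrix.one_mulVec]

theorem lieCoframe_mulVec_frame (hx : x ∈ Φ.dom) (b : Fin 5) :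
    Φ.lieCoframe ε x *ᵥ Φ.frame b x =
      Pi.single b (![1, 1, 1, 1, (3 / (2 * sqrtTwo)) * Φ.phase (-ε) x] b) := by
  rw [lieCoframe_eq, ← Matrix.mulVec_mulVec, coframe_mulVec_frame hx]
  funext A
  rw [Matrix.mulVec_diagonal]
  by_cases h : A = b
  · subst h
    simp
  · simp [Pi.single_eq_of_ne h]

/-- The coefficient of ∂_u in the second generators is, up to sign, reciprocal to that of du in ν,
so these generators have constant components with respect to the coframe. -/
theorem nu_coeff_mul_phase :
    (2 * sqrtTwo / 3 * Φ.phase ε x) * ((3 / (2 * sqrtTwo)) * Φ.phase (-ε) x) = 1 := by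
  have h := phase_neg_mul (Φ := Φ) (ε := ε) (x := x)
  have h2 := sqrtTwo_ne_zero
  field_simp
  linear_combination h

theorem lieCoframe_mulVec_X1 (hx : x ∈ Φ.dom) :
    Φ.lieCoframe ε x *ᵥ Φ.X1 x = ![0, 1, 0, -1, 0] := by
  simp only [X1, partialR, E2, Matrix.mulVec_add, Matrix.mulVec_neg, lieCoframe_mulVec_frame hx]
  funext A
  fin_cases A <;> simp

theorem lieCoframe_mulVec_X1Tilde (hx : x ∈ Φ.dom) :
    Φ.lieCoframe ε x *ᵥ Φ.X1Tilde x = ![0, 1, 0, -(-1), 0] := by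
  simp only [X1Tilde, partialR, E2, Matrix.mulVec_add, lieCoframe_mulVec_frame hx]
  funext A
  fin_cases A <;> simp

theorem lieCoframe_mulVec_X2 (hx : x ∈ Φ.dom) :
    Φ.lieCoframe ε x *ᵥ Φ.X2 ε x = ![1, 0, 1 * (ε * (Complex.I / 3)), 0, -1] := by
  have h := nu_coeff_mul_phase (Φ := Φ) (ε := ε) (x := x)
  simp only [X2, partialU, E1, E3, Matrix.mulVec_add, Matrix.mulVec_sub, Matrix.mulVec_smul,
    lieCoframe_mulVec_frame hx]
  funext A
  fin_cases A <;> simp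
  exact h

theorem lieCoframe_mulVec_X2Tilde (hx : x ∈ Φ.dom) :
    Φ.lieCoframe ε x *ᵥ Φ.X2Tilde ε x = ![1, 0, (-1) * (ε * (Complex.I / 3)), 0, -(-1)] := by
  have h := nu_coeff_mul_phase (Φ := Φ) (ε := ε) (x := x)
  simp only [X2Tilde, partialU, E1, E3, Matrix.mulVec_add, Matrix.mulVec_sub, Matrix.mulVec_smul,
    lieCoframe_mulVec_frame hx]
  funext A
  fin_cases A <;> simp
  exact h

theorem lieForm_dotProduct (c v : Fin 5 → ℂ) :
    Φ.lieForm ε c x ⬝ᵥ v = c ⬝ᵥ (Φ.lieCoframe ε x *ᵥ v) := (Matrix.dotProduct_mulVec _ _ _).symm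

theorem exists_eq_lieForm (hx : x ∈ Φ.dom) (ξ : Fin 5 → ℂ) : ∃ c, ξ = Φ.lieForm ε c x := by
  refine ⟨ξ ᵥ* (Φ.lieCoframe ε x)⁻¹, ?_⟩
  rw [lieForm, Matrix.vecMul_vecMul, Matrix.nonsing_inv_mul _
    ((Matrix.isUnit_iff_isUnit_det _).mp (isUnit_lieCoframe hx)), Matrix.vecMul_one]

/-- Both distributions at once: s = 1 gives `distr` and s = -1 gives `distrTilde`, with k = ±i/3. A
form with coefficients c kills X and Y exactly when c₃ = s c₁ and c₄ = s c₀ + k c₂, by s² = 1, so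
c₀, c₁, c₂ are free. -/
theorem annihilator_span_pair (hx : x ∈ Φ.dom) {s k : ℂ} (hs : s ^ 2 = 1) {X Y : Fin 5 → ℂ}
    (hX : Φ.lieCoframe ε x *ᵥ X = ![0, 1, 0, -s, 0])
    (hY : Φ.lieCoframe ε x *ᵥ Y = ![1, 0, s * k, 0, -s]) :
    annihilator (Submodule.span ℂ {X, Y}) = Submodule.span ℂ {Φ.lieForm ε ![1, 0, 0, 0, s] x,
      Φ.lieForm ε ![0, 1, 0, s, 0] x, Φ.lieForm ε ![0, 0, 1, 0, k] x} := by
  have hdX : ∀ c, Φ.lieForm ε c x ⬝ᵥ X = c 1 - s * c 3 := fun c => by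
    rw [lieForm_dotProduct, hX]
    simp [dotProduct, Fin.sum_univ_five]
    ring
  have hdY : ∀ c, Φ.lieForm ε c x ⬝ᵥ Y = c 0 + s * k * c 2 - s * c 4 := fun c => by
    rw [lieForm_dotProduct, hY]
    simp [dotProduct, Fin.sum_univ_five]
    ring
  refine le_antisymm ?_ ?_
  · intro ξ hξ
    obtain ⟨c, rfl⟩ := exists_eq_lieForm (ε := ε) hx ξ
    have h1 := (hdX c).symm.trans (hξ X (Submodule.subset_span (by simp)))
    have h2 := (hdY c).symm.trans (hξ Y (Submodule.subset_span (by simp)))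
    rw [Submodule.mem_span_triple]
    refine ⟨c 0, c 1, c 2, ?_⟩
    funext i
    simp only [Pi.add_apply, Pi.smul_apply, smul_eq_mul, lieForm_apply]
    simp
    linear_combination (s * Φ.dr x i) * h1 + (s * Φ.nu ε x i) * h2
      + (Φ.dr x i * c 3 + Φ.nu ε x i * (c 4 - k * c 2)) * hs
  · rw [Submodule.span_le]
    have key : ∀ c : Fin 5 → ℂ, c 1 - s * c 3 = 0 → c 0 + s * k * c 2 - s * c 4 = 0 →
        Φ.lieForm ε c x ∈ annihilator (Submodule.span ℂ {X, Y}) := by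
      intro c h1 h2 v hv
      obtain ⟨a, b, rfl⟩ := Submodule.mem_span_pair.mp hv
      rw [dotProduct_add, dotProduct_smul, dotProduct_smul, hdX, hdY, h1, h2]
      simp
    rintro _ (rfl | rfl | rfl)
    · refine key _ (by simp) ?_
      simp
      linear_combination -hs
    · refine key _ ?_ (by simp)
      simp
      linear_combination -hs
    · refine key _ (by simp) ?_
      simp

theorem annihilator_distr (hx : x ∈ Φ.dom) : annihilator (Φ.distr ε x) =
    Submodule.span ℂ {Φ.omega1 ε x, Φ.omega2 x, Φ.omega3 ε x} := by
  rw [omega1_eq, omega2_eq (ε := ε), omega3_eq]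
  exact annihilator_span_pair hx (by norm_num) (lieCoframe_mulVec_X1 hx) (lieCoframe_mulVec_X2 hx)

theorem annihilator_distrTilde (hx : x ∈ Φ.dom) : annihilator (Φ.distrTilde ε x) =
    Submodule.span ℂ {Φ.omegaBar1 ε x, Φ.omegaBar2 x, Φ.omegaBar3 ε x} := by
  rw [omegaBar1_eq, omegaBar2_eq (ε := ε), omegaBar3, omega3_eq]
  exact annihilator_span_pair hx (by norm_num) (lieCoframe_mulVec_X1Tilde hx)
    (lieCoframe_mulVec_X2Tilde hx)

/-! ### The metric -/

/-- The metric and the Cartan equations depend on the choice of sign only through this relation. -/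
theorem eps_I_sq (hε : ε = 1 ∨ ε = -1) : (ε * Complex.I) ^ 2 = -1 := by
  rcases hε with rfl | rfl <;> simp

/-- The components of the metric with respect to `σ₁, σ₂, σ₃, dr, ν`. -/
def metricMatrix (ε : ℂ) : Matrix (Fin 5) (Fin 5) ℂ :=
  !![3 / 2, 0, 0, 0, 1 / 2;
    0, 3 / 2, 0, 1 / 2, 0;
    0, 0, 3 / 2, 0, ε * Complex.I / 2;
    0, 1 / 2, 0, -1 / 2, 0;
    1 / 2, 0, ε * Complex.I / 2, 0, -2 / 3]

theorem det_metricMatrix (hε : ε = 1 ∨ ε = -1) : (metricMatrix ε).det = 3 / 2 := by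
  have h := eps_I_sq hε
  unfold metricMatrix
  simp [Matrix.det_succ_row_zero, Fin.sum_univ_succ, Fin.succAbove]
  linear_combination (3 / 8) * h

theorem gTilde_apply (hε : ε = 1 ∨ ε = -1) (x : Pt) (i j : Fin 5) : Φ.gTilde ε x i j =
    (3 / 2) * (Φ.sigma 0 x i * Φ.sigma 0 x j + Φ.sigma 1 x i * Φ.sigma 1 x j
      + Φ.sigma 2 x i * Φ.sigma 2 x j) - (1 / 2) * Φ.dr x i * Φ.dr x j
      + (1 / 2) * (Φ.sigma 1 x i * Φ.dr x j + Φ.dr x i * Φ.sigma 1 x j)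
      + (1 / 2) * (Φ.nu ε x i * (Φ.sigma 0 x j + ε * Complex.I * Φ.sigma 2 x j)
        + (Φ.sigma 0 x i + ε * Complex.I * Φ.sigma 2 x i) * Φ.nu ε x j)
      - (2 / 3) * Φ.nu ε x i * Φ.nu ε x j := by
  have h := eps_I_sq hε
  simp only [gTilde, omegaBar3, omega1_eq, omega2_eq (ε := ε), omega3_eq, omega4_eq (ε := ε),
    omega5_eq, omegaBar1_eq, omegaBar2_eq (ε := ε), Matrix.add_apply, Matrix.smul_apply, symProd,
    Matrix.of_apply, lieForm_apply, smul_eq_mul]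
  simp
  -- The squares of ω₃ = ω̄₃ contribute (3/2)(±i/3)² = -1/6 to the coefficient of ν², which becomes
  -- -2/3.
  linear_combination (1 / 6) * Φ.nu ε x i * Φ.nu ε x j * h

theorem gTilde_eq (hε : ε = 1 ∨ ε = -1) (x : Pt) :
    Φ.gTilde ε x = (Φ.lieCoframe ε x)ᵀ * metricMatrix ε * Φ.lieCoframe ε x := by
  ext i j
  rw [gTilde_apply hε]
  simp [Matrix.mul_apply, Fin.sum_univ_five, metricMatrix, lieCoframe]
  ring

theorem isMetricOn_gTilde (hε : ε = 1 ∨ ε = -1) : IsMetricOn Φ.dom (Φ.gTilde ε) where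
  smooth i j := by
    simp only [gTilde_eq hε, Matrix.mul_apply, Matrix.transpose_apply]
    have hs : ∀ A i, ContDiffOn ℝ ∞ (fun x => Φ.lieCoframe ε x A i) Φ.dom := fun A i => by
      fin_cases A
      · exact smooth_sigma 0 i
      · exact smooth_sigma 1 i
      · exact smooth_sigma 2 i
      · exact smooth_dr i
      · exact smooth_nu i
    exact ContDiffOn.sum fun A _ => (ContDiffOn.sum fun B _ => (hs B i).mul contDiffOn_const).mul
      (hs A j)
  symm x _ := Matrix.IsSymm.ext fun i j => by
    rw [gTilde_apply hε, gTilde_apply hε]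
    ring
  nondeg x hx := by
    have h := isUnit_iff_ne_zero.mp
      ((Matrix.isUnit_iff_isUnit_det _).mp (isUnit_lieCoframe (ε := ε) hx))
    rw [gTilde_eq hε, Matrix.det_mul, Matrix.det_mul, Matrix.det_transpose, det_metricMatrix hε]
    exact mul_ne_zero (mul_ne_zero h (by norm_num)) h

/-! ### Nurowski's conformal class -/

/-- The coefficients of a coframe that satisfies Cartan's structure equations. -/
def cartanCoframe (ε : ℂ) : Matrix (Fin 5) (Fin 5) ℂ :=
  !![9 / 8, 0, 0, 0, 9 / 8;
    0, 9 / 8, 0, 9 / 8, 0;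
    0, 0, 9 / 8, 0, 3 * (ε * Complex.I) / 8;
    0, -3 / 4, 0, 1 / 4, 0;
    3 / 4, 0, 0, 0, -1 / 4]

/-- The coefficients of the connection forms in Cartan's structure equations. -/
def cartanConnection (ε : ℂ) : Matrix (Fin 7) (Fin 5) ℂ :=
  !![0, 0, 0, 0, 0;
    0, 0, 1 / 4, 0, -(ε * Complex.I) / 4;
    0, 0, -1 / 4, 0, ε * Complex.I / 4;
    0, 0, 0, 0, 0;
    0, 1 / 4, 0, -1 / 12, 0;
    -1 / 4, 0, 0, 0, 1 / 12;
    0, 0, 1 / 6, 0, ε * Complex.I / 18]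

theorem det_cartanCoframe : (cartanCoframe ε).det ≠ 0 := by
  unfold cartanCoframe
  simp [Matrix.det_succ_row_zero, Fin.sum_univ_succ, Fin.succAbove]
  norm_num

theorem linearIndependent_cartanCoframe (hx : x ∈ Φ.dom) :
    LinearIndependent ℂ (fun a => Φ.lieForm ε (cartanCoframe ε a) x) := by
  have h : IsUnit (cartanCoframe ε * Φ.lieCoframe ε x) :=
    ((Matrix.isUnit_iff_isUnit_det _).mpr (isUnit_iff_ne_zero.mpr det_cartanCoframe)).mul
      (isUnit_lieCoframe hx)
  exact Matrix.linearIndependent_rows_of_isUnit h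

/-- The coframe is θₐ = (9/8) ωₐ for a ≤ 3, θ₄ = ω₄ - (3/4) ω₂, θ₅ = ω₅ + (3/4) ω₁. The factor is
forced once θ₄ ≡ ω₄ and θ₅ ≡ ω₅ modulo ω₁, ω₂: there dω₃ ≡ (8/9) ω₄ ∧ ω₅, while dω₁ ≡ ω₃ ∧ ω₄
requires equal factors for θ₁ and θ₃. With constant coefficients each equation compares components
of two-forms. -/
theorem cartanEquations (hε : ε = 1 ∨ ε = -1) : CartanEquations Φ.dom
    (fun a => Φ.lieForm ε (cartanCoframe ε a)) (fun b => Φ.lieForm ε (cartanConnection ε b)) where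
  eq1 x hx := by
    rw [extD_lieForm hx]
    ext i j
    simp [wedge, lieForm_apply, cartanCoframe, cartanConnection]
    ring
  eq2 x hx := by
    rw [extD_lieForm hx]
    ext i j
    simp [wedge, lieForm_apply, cartanCoframe, cartanConnection]
    ring
  eq3 x hx := by
    have h := eps_I_sq hε
    rw [extD_lieForm hx]
    ext i j
    simp [wedge, lieForm_apply, cartanCoframe, cartanConnection]
    linear_combination (Φ.dr x j * Φ.nu ε x i - Φ.dr x i * Φ.nu ε x j) / 8 * h
  eq4 x hx := by
    rw [extD_lieForm hx]
    ext i j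
    simp [wedge, lieForm_apply, cartanCoframe, cartanConnection]
    ring
  eq5 x hx := by
    rw [extD_lieForm hx]
    ext i j
    simp [wedge, lieForm_apply, cartanCoframe, cartanConnection]
    ring

theorem span_cartanCoframe (x : Pt) :
    Submodule.span ℂ {Φ.omega1 ε x, Φ.omega2 x, Φ.omega3 ε x} =
      Submodule.span ℂ {Φ.lieForm ε (cartanCoframe ε 0) x, Φ.lieForm ε (cartanCoframe ε 1) x,
        Φ.lieForm ε (cartanCoframe ε 2) x} := by
  have h0 : Φ.lieForm ε (cartanCoframe ε 0) x = (9 / 8 : ℂ) • Φ.omega1 ε x := by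
    funext i
    simp [lieForm_apply, cartanCoframe, omega1_eq]
    ring
  have h1 : Φ.lieForm ε (cartanCoframe ε 1) x = (9 / 8 : ℂ) • Φ.omega2 x := by
    funext i
    simp [lieForm_apply, cartanCoframe, omega2_eq (ε := ε)]
    ring
  have h2 : Φ.lieForm ε (cartanCoframe ε 2) x = (9 / 8 : ℂ) • Φ.omega3 ε x := by
    funext i
    simp [lieForm_apply, cartanCoframe, omega3_eq]
    ring
  have hu : IsUnit (9 / 8 : ℂ) := by
    rw [isUnit_iff_ne_zero]
    norm_num
  rw [h0, h1, h2, ← Submodule.span_smul_eq_of_isUnit _ _ hu]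
  congr 1
  simp [Set.smul_set_insert]

/-- Since ω̄₁ = ω₁ + 2ω₅ and ω̄₂ = ω₂ - 2ω₄, the squares of ω₄ and ω₅ cancel and g̃ = 2ω₁ω₅ - 2ω₂ω₄
+ (3/2)(ω₁² + ω₂² + ω₃²). The shifts by 3/4 in θ₄ and θ₅ absorb ω₁² and ω₂². -/
theorem gTilde_eq_nurowskiMetric (hε : ε = 1 ∨ ε = -1) (x : Pt) : Φ.gTilde ε x =
    (8 / 9 : ℂ) • nurowskiMetric (fun a => Φ.lieForm ε (cartanCoframe ε a)) x := by
  have h := eps_I_sq hε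
  ext i j
  rw [gTilde_apply hε]
  simp [nurowskiMetric, symProd, lieForm_apply, cartanCoframe]
  linear_combination -(1 / 6) * Φ.nu ε x i * Φ.nu ε x j * h

/-- Every rescaling of the metric represents Nurowski's conformal class. -/
theorem representsNurowskiClass_rescale (hε : ε = 1 ∨ ε = -1) {lam : Pt → ℂ}
    (hs : ContDiffOn ℝ ∞ lam Φ.dom) (h0 : ∀ x ∈ Φ.dom, lam x ≠ 0) :
    RepresentsNurowskiClass Φ.dom (Φ.distr ε) (rescale lam (Φ.gTilde ε)) := by
  intro x hx
  refine ⟨Φ.dom, Φ.isOpen_dom, hx, subset_rfl, fun a => Φ.lieForm ε (cartanCoframe ε a),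
    fun b => Φ.lieForm ε (cartanConnection ε b), fun y => lam y * (8 / 9),
    fun a => smooth_lieForm _, fun b => smooth_lieForm _, hs.mul contDiffOn_const,
    fun y hy => linearIndependent_cartanCoframe hy, fun y hy => ?_, cartanEquations hε,
    fun y hy => mul_ne_zero (h0 y hy) (by norm_num), fun y hy => ?_⟩
  · rw [annihilator_distr hy, span_cartanCoframe]
  · rw [rescale, gTilde_eq_nurowskiMetric hε, smul_smul]

theorem isMetricOn_rescale {V : Set Pt} {g : BilinField} (hg : IsMetricOn V g) {lam : Pt → ℂ}
    (hs : ContDiffOn ℝ ∞ lam V) (h0 : ∀ x ∈ V, lam x ≠ 0) : IsMetricOn V (rescale lam g) where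
  smooth i j := hs.mul (hg.smooth i j)
  symm x hx := (hg.symm x hx).smul _
  nondeg x hx := by
    rw [rescale, Matrix.det_smul]
    exact mul_ne_zero (pow_ne_zero _ (h0 x hx)) (hg.nondeg x hx)

end LocalParam

namespace LocalParam

variable {Φ : LocalParam} {x : Pt} {ε : ℂ}

/-! ### Flat coordinates -/

/-- The square root `e^{± i r / 6}` of the phase. -/
def rootPhase (Φ : LocalParam) (ε : ℂ) (x : Pt) : ℂ :=
  Complex.exp (ε * (Complex.I / 6) * (Φ.r x : ℂ))

theorem rootPhase_sq : Φ.rootPhase ε x ^ 2 = Φ.phase ε x := by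
  rw [rootPhase, phase, ← Complex.exp_nat_mul]
  congr 1
  push_cast
  ring

theorem contDiffOn_rootPhase : ContDiffOn ℝ ∞ (Φ.rootPhase ε) Φ.dom :=
  (contDiffOn_const.mul contDiffOn_r).cexp

theorem pd_rootPhase (hx : x ∈ Φ.dom) (i : Fin 5) :
    pd i (Φ.rootPhase ε) x = (ε * (Complex.I / 6)) * Φ.rootPhase ε x * Φ.dr x i := by
  have h := smooth_differentiableAt Φ.isOpen_dom contDiffOn_r hx
  unfold rootPhase
  rw [pd_exp (h.const_mul _), pd_const_mul _ h]
  simp only [dr]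
  ring

/-- The components of the image of `(1, ± i)` under the `SU(2)` component. -/
def column (Φ : LocalParam) (ε : ℂ) (k : Fin 2) (x : Pt) : ℂ :=
  Φ.entry k 0 x + ε * Complex.I * Φ.entry k 1 x

theorem contDiffOn_column (k : Fin 2) : ContDiffOn ℝ ∞ (Φ.column ε k) Φ.dom :=
  (Φ.contDiffOn_entry k 0).add (contDiffOn_const.mul (Φ.contDiffOn_entry k 1))

/-- The vectors (1, ±i) are eigenvectors of `su2Basis 1` with eigenvalues ±i/2, and the other two
basis matrices exchange them up to scalars. -/
theorem pd_column (hε : ε = 1 ∨ ε = -1) (hx : x ∈ Φ.dom) (i : Fin 5) (k : Fin 2) :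
    pd i (Φ.column ε k) x = (Complex.I / 2) * (Φ.sigma 2 x i + ε * Complex.I * Φ.sigma 0 x i)
        * Φ.column (-ε) k x + (ε * Complex.I / 2) * Φ.sigma 1 x i * Φ.column ε k x := by
  unfold column
  rw [pd_add (diff_entry hx k 0) ((diff_entry hx k 1).const_mul _),
    pd_const_mul _ (diff_entry hx k 1), pd_entry_zero hx, pd_entry_one hx]
  rcases hε with rfl | rfl
  · linear_combination ((Complex.I / 2) * Φ.entry k 1 x * Φ.sigma 0 x i
      - (Complex.I / 2) * Φ.entry k 0 x * Φ.sigma 1 x i) * Complex.I_sq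
  · linear_combination ((Complex.I / 2) * Φ.entry k 1 x * Φ.sigma 0 x i
      + (Complex.I / 2) * Φ.entry k 0 x * Φ.sigma 1 x i) * Complex.I_sq

/-- As det p = 1, this is the determinant of the pair (1, ±i), (1, ∓i). -/
theorem column_det (x : Pt) : Φ.column ε 0 x * Φ.column (-ε) 1 x
    - Φ.column ε 1 x * Φ.column (-ε) 0 x = -2 * (ε * Complex.I) := by
  have h := Φ.entry_det x
  unfold column
  linear_combination -2 * (ε * Complex.I) * h

/-- The components of `e^{± i r / 6} p (1, ∓ i)`. -/
def flatW (Φ : LocalParam) (ε : ℂ) (k : Fin 2) (x : Pt) : ℂ :=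
  Φ.rootPhase ε x * Φ.column (-ε) k x

/-- The components of `e^{± i r / 2} p (1, ± i) + κ u e^{± i r / 6} p (1, ∓ i)`, where `κ` is a
constant. -/
def flatZ (Φ : LocalParam) (ε : ℂ) (k : Fin 2) (x : Pt) : ℂ :=
  Φ.rootPhase ε x ^ 3 * Φ.column ε k x
    + (ε * Complex.I * Complex.I * sqrtTwo / 4) * ((Φ.u x : ℂ) * Φ.flatW ε k x)

theorem contDiffOn_flatW (k : Fin 2) : ContDiffOn ℝ ∞ (Φ.flatW ε k) Φ.dom :=
  contDiffOn_rootPhase.mul (contDiffOn_column k)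

theorem contDiffOn_flatZ (k : Fin 2) : ContDiffOn ℝ ∞ (Φ.flatZ ε k) Φ.dom :=
  ((contDiffOn_rootPhase.pow 3).mul (contDiffOn_column k)).add
    (contDiffOn_const.mul (contDiffOn_u.mul (contDiffOn_flatW k)))

/-! The components of `dW` and `dZ`. -/

/-- The coefficient of `p (1, ± i)` in `dW`. -/
def flatS (Φ : LocalParam) (ε : ℂ) : OneForm := fun x i =>
  Φ.rootPhase ε x * ((Complex.I / 2) * (Φ.sigma 2 x i - ε * Complex.I * Φ.sigma 0 x i))

/-- The coefficient of `p (1, ∓ i)` in `dW`. -/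
def flatT (Φ : LocalParam) (ε : ℂ) : OneForm := fun x i =>
  Φ.rootPhase ε x * (ε * Complex.I * (Φ.dr x i / 6 - Φ.sigma 1 x i / 2))

/-- The coefficient of `p (1, ± i)` in `dZ`. -/
def flatP (Φ : LocalParam) (ε : ℂ) : OneForm := fun x i =>
  Φ.rootPhase ε x ^ 3 * (ε * Complex.I / 2 * (Φ.dr x i + Φ.sigma 1 x i))
    + (ε * Complex.I * Complex.I * sqrtTwo / 4) * (Φ.u x : ℂ) * Φ.flatS ε x i

/-- The coefficient of `p (1, ∓ i)` in `dZ`. -/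
def flatQ (Φ : LocalParam) (ε : ℂ) : OneForm := fun x i =>
  Φ.rootPhase ε x ^ 3 * (Complex.I / 2 * (Φ.sigma 2 x i + ε * Complex.I * Φ.sigma 0 x i))
    + (ε * Complex.I * Complex.I * sqrtTwo / 4) *
      (Φ.rootPhase ε x * Φ.du x i + (Φ.u x : ℂ) * Φ.flatT ε x i)

theorem pd_flatW (hε : ε = 1 ∨ ε = -1) (hx : x ∈ Φ.dom) (i : Fin 5) (k : Fin 2) :
    pd i (Φ.flatW ε k) x =
      Φ.flatS ε x i * Φ.column ε k x + Φ.flatT ε x i * Φ.column (-ε) k x := by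
  have hε' : -ε = 1 ∨ -ε = -1 := by
    rcases hε with rfl | rfl <;> simp
  unfold flatW
  rw [pd_mul (smooth_differentiableAt Φ.isOpen_dom contDiffOn_rootPhase hx)
    (smooth_differentiableAt Φ.isOpen_dom (contDiffOn_column k) hx), pd_rootPhase hx,
    pd_column hε' hx, neg_neg, flatS, flatT]
  ring

theorem pd_flatZ (hε : ε = 1 ∨ ε = -1) (hx : x ∈ Φ.dom) (i : Fin 5) (k : Fin 2) :
    pd i (Φ.flatZ ε k) x =
      Φ.flatP ε x i * Φ.column ε k x + Φ.flatQ ε x i * Φ.column (-ε) k x := by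
  have hd := fun {F : Pt → ℂ} (hF : ContDiffOn ℝ ∞ F Φ.dom) =>
    smooth_differentiableAt Φ.isOpen_dom hF hx
  have hcube : pd i (fun x => Φ.rootPhase ε x ^ 3) x =
      (ε * Complex.I / 2) * Φ.rootPhase ε x ^ 3 * Φ.dr x i := by
    have : (fun x => Φ.rootPhase ε x ^ 3) =
        fun x => Φ.rootPhase ε x * (Φ.rootPhase ε x * Φ.rootPhase ε x) := by
      funext x
      ring
    rw [this, pd_mul (hd contDiffOn_rootPhase)
      (hd (contDiffOn_rootPhase.mul contDiffOn_rootPhase)), pd_mul (hd contDiffOn_rootPhase)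
      (hd contDiffOn_rootPhase), pd_rootPhase hx]
    ring
  have hu : pd i (fun x => (Φ.u x : ℂ)) x = Φ.du x i := rfl
  unfold flatZ
  rw [pd_add (hd ((contDiffOn_rootPhase.pow 3).mul (contDiffOn_column k)))
    (hd (contDiffOn_const.mul (contDiffOn_u.mul (contDiffOn_flatW k)))),
    pd_mul (hd (contDiffOn_rootPhase.pow 3)) (hd (contDiffOn_column k)),
    pd_const_mul _ (hd (contDiffOn_u.mul (contDiffOn_flatW k))),
    pd_mul (hd contDiffOn_u) (hd (contDiffOn_flatW k)), pd_flatW hε hx, pd_column hε hx, hcube, hu,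
    flatP, flatQ, flatW]
  ring

/-- Complex coordinates `y` in which `e^{± 2 i r / 3} g̃ = ∑ₐ (dyᵃ)²`. -/
def flatCoords (Φ : LocalParam) (ε : ℂ) (x : Pt) : Fin 5 → ℂ :=
  ![(3 * (ε * Complex.I) / 4) * Φ.flatZ ε 0 x + Φ.flatW ε 1 x,
    Complex.I * ((3 * (ε * Complex.I) / 4) * Φ.flatZ ε 0 x - Φ.flatW ε 1 x),
    Complex.I * ((3 * (ε * Complex.I) / 4) * Φ.flatZ ε 1 x + Φ.flatW ε 0 x),
    (3 * (ε * Complex.I) / 4) * Φ.flatZ ε 1 x - Φ.flatW ε 0 x,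
    (Complex.I * ((Real.sqrt 3 : ℝ) : ℂ) / 2) * (Φ.u x : ℂ)]

theorem smooth_flatCoords : SmoothForm Φ.dom (Φ.flatCoords ε) := by
  have hZ := fun k => contDiffOn_flatZ (Φ := Φ) (ε := ε) k
  have hW := fun k => contDiffOn_flatW (Φ := Φ) (ε := ε) k
  intro a
  fin_cases a
  · exact (contDiffOn_const.mul (hZ 0)).add (hW 1)
  · exact contDiffOn_const.mul ((contDiffOn_const.mul (hZ 0)).sub (hW 1))
  · exact contDiffOn_const.mul ((contDiffOn_const.mul (hZ 1)).add (hW 0))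
  · exact (contDiffOn_const.mul (hZ 1)).sub (hW 0)
  · exact contDiffOn_const.mul contDiffOn_u

theorem pdVec_flatCoords (hx : x ∈ Φ.dom) (i : Fin 5) : pdVec i (Φ.flatCoords ε) x =
    ![(3 * (ε * Complex.I) / 4) * pd i (Φ.flatZ ε 0) x + pd i (Φ.flatW ε 1) x,
      Complex.I * ((3 * (ε * Complex.I) / 4) * pd i (Φ.flatZ ε 0) x - pd i (Φ.flatW ε 1) x),
      Complex.I * ((3 * (ε * Complex.I) / 4) * pd i (Φ.flatZ ε 1) x + pd i (Φ.flatW ε 0) x),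
      (3 * (ε * Complex.I) / 4) * pd i (Φ.flatZ ε 1) x - pd i (Φ.flatW ε 0) x,
      (Complex.I * ((Real.sqrt 3 : ℝ) : ℂ) / 2) * Φ.du x i] := by
  have hZ := fun k => smooth_differentiableAt Φ.isOpen_dom (contDiffOn_flatZ (ε := ε) k) hx
  have hW := fun k => smooth_differentiableAt Φ.isOpen_dom (contDiffOn_flatW (ε := ε) k) hx
  have hcZ := fun k => (hZ k).const_mul (3 * (ε * Complex.I) / 4)
  have hu := smooth_differentiableAt Φ.isOpen_dom contDiffOn_u hx
  have h1 := pd_sub (hcZ 0) (hW 1) i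
  have h2 := pd_add (hcZ 1) (hW 0) i
  rw [pd_const_mul _ (hZ 0)] at h1
  rw [pd_const_mul _ (hZ 1)] at h2
  funext a
  fin_cases a
  · exact (pd_add (hcZ 0) (hW 1) i).trans (by rw [pd_const_mul _ (hZ 0)]; rfl)
  · exact (pd_const_mul _ ((hcZ 0).sub (hW 1)) i).trans
      (congrArg (Complex.I * ·) h1)
  · exact (pd_const_mul _ ((hcZ 1).add (hW 0)) i).trans
      (congrArg (Complex.I * ·) h2)
  · exact (pd_sub (hcZ 1) (hW 0) i).trans (by rw [pd_const_mul _ (hZ 1)]; rfl)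
  · exact pd_const_mul _ hu i

theorem sqrt_three_sq : ((Real.sqrt 3 : ℝ) : ℂ) ^ 2 = 3 := by
  rw [← Complex.ofReal_pow, Real.sq_sqrt (by norm_num)]
  norm_num

/-- The first four coordinates are sums and differences of null coordinates: (A + B)² + (i(A - B))²
= 4AB, and similarly -4CD for the second pair. So the sum of squares is ±3i (dZ₀ dW₁ - dZ₁ dW₀) -
(3/4) du², and `column_det` evaluates the determinant in the basis p(1, ±i), p(1, ∓i). -/
theorem pdVec_flatCoords_dotProduct (hε : ε = 1 ∨ ε = -1) (hx : x ∈ Φ.dom) (i j : Fin 5) :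
    pdVec i (Φ.flatCoords ε) x ⬝ᵥ pdVec j (Φ.flatCoords ε) x =
      3 * (Φ.flatP ε x i * Φ.flatT ε x j - Φ.flatQ ε x i * Φ.flatS ε x j
        + Φ.flatP ε x j * Φ.flatT ε x i - Φ.flatQ ε x j * Φ.flatS ε x i)
      - (3 / 4) * Φ.du x i * Φ.du x j := by
  have h := column_det (Φ := Φ) (ε := ε) x
  have hj := eps_I_sq hε
  have h3 := sqrt_three_sq
  rw [pdVec_flatCoords hx, pdVec_flatCoords hx]
  simp only [dotProduct, Fin.sum_univ_five, Matrix.cons_val, pd_flatZ hε hx, pd_flatW hε hx]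
  generalize Φ.flatP ε x = P
  generalize Φ.flatQ ε x = Q
  generalize Φ.flatS ε x = S
  generalize Φ.flatT ε x = T
  generalize Φ.column ε 0 x = z0 at *
  generalize Φ.column ε 1 x = z1 at *
  generalize Φ.column (-ε) 0 x = w0 at *
  generalize Φ.column (-ε) 1 x = w1 at *
  generalize ((Real.sqrt 3 : ℝ) : ℂ) = t at *
  generalize ε * Complex.I = e at *
  linear_combination
    ((3 / 4 * e * (P i * z0 + Q i * w0) - (S i * z1 + T i * w1))
        * (3 / 4 * e * (P j * z0 + Q j * w0) - (S j * z1 + T j * w1))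
      + (3 / 4 * e * (P i * z1 + Q i * w1) + (S i * z0 + T i * w0))
        * (3 / 4 * e * (P j * z1 + Q j * w1) + (S j * z0 + T j * w0))
      + t ^ 2 / 4 * Φ.du x i * Φ.du x j) * Complex.I_sq
    - Φ.du x i * Φ.du x j / 4 * h3
    + (3 / 2) * e * (P i * T j - Q i * S j + P j * T i - Q j * S i) * h
    - 3 * (P i * T j - Q i * S j + P j * T i - Q j * S i) * hj

theorem nu_apply (x : Pt) (i : Fin 5) :
    Φ.nu ε x i = (3 * sqrtTwo / 4) * Φ.phase (-ε) x * Φ.du x i := by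
  have h : 3 / (2 * sqrtTwo) = 3 * sqrtTwo / 4 := by
    have h0 := sqrtTwo_ne_zero
    have h2 := sqrtTwo_sq
    field_simp
    linear_combination -2 * h2
  simp only [nu, h, Pi.smul_apply, smul_eq_mul]

/-- The term κ u dW of dZ contributes nothing, since dW₀ dW₁ - dW₁ dW₀ = 0 for symmetric products;
hence u disappears. The term κ W du produces the products of ν with σ₁ and σ₃, which fixes κ =
∓√2/4, and the last coordinate supplies the square of ν. -/
theorem phase_sq_mul_gTilde (hε : ε = 1 ∨ ε = -1) (hx : x ∈ Φ.dom) (i j : Fin 5) :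
    Φ.phase ε x ^ 2 * Φ.gTilde ε x i j =
      pdVec i (Φ.flatCoords ε) x ⬝ᵥ pdVec j (Φ.flatCoords ε) x := by
  have hn := phase_neg_mul (Φ := Φ) (ε := ε) (x := x)
  have hj := eps_I_sq hε
  have ht := sqrtTwo_sq
  rw [pdVec_flatCoords_dotProduct hε hx, gTilde_apply hε, nu_apply, nu_apply]
  simp only [flatP, flatQ, flatS, flatT]
  rw [← rootPhase_sq (ε := ε)] at hn ⊢
  generalize Φ.rootPhase ε x = s at *
  generalize Φ.phase (-ε) x = n at *
  generalize sqrtTwo = t at *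
  generalize ε * Complex.I = e at *
  generalize Φ.sigma 0 x = s0
  generalize Φ.sigma 1 x = s1
  generalize Φ.sigma 2 x = s2
  generalize Φ.dr x = r
  generalize Φ.du x = d
  have hI := Complex.I_sq
  linear_combination -(
    (3 / 2) * s ^ 4 * ((r i + s1 i) * (r j / 6 - s1 j / 2) + (r j + s1 j) * (r i / 6 - s1 i / 2)) * hj
    - (3 / 4) * s ^ 4 * ((s2 i + e * s0 i) * (s2 j - e * s0 j)
      + (s2 j + e * s0 j) * (s2 i - e * s0 i)) * hI
    - (3 / 2) * s ^ 4 * s0 i * s0 j * hj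
    - (3 / 8) * e * t * s ^ 2 * (d i * (s2 j - e * s0 j) + d j * (s2 i - e * s0 i)) * hI
    - (3 / 8) * t * s ^ 2 * (d i * s0 j + d j * s0 i) * hj
    - (3 / 8) * t * s ^ 2 * (d i * (s0 j + e * s2 j) + d j * (s0 i + e * s2 i)) * hn
    + (3 / 8) * n ^ 2 * s ^ 4 * d i * d j * ht
    + (3 / 4) * (n * s ^ 2 + 1) * d i * d j * hn)

/-- The same quadratic form evaluated on y instead of dy: the part of Z along W drops out of Z₀W₁ -
Z₁W₀, leaving s⁴ times the determinant of `column_det`. It exhibits the conformal factor of g̃ as a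
function of y. -/
theorem flatCoords_sq (hε : ε = 1 ∨ ε = -1) (x : Pt) :
    Φ.flatCoords ε x 0 ^ 2 + Φ.flatCoords ε x 1 ^ 2 + Φ.flatCoords ε x 2 ^ 2
      + Φ.flatCoords ε x 3 ^ 2 = 6 * Φ.phase ε x ^ 2 := by
  have h := column_det (Φ := Φ) (ε := ε) x
  have hj := eps_I_sq hε
  simp only [flatCoords, Matrix.cons_val, flatZ]
  simp only [flatW, ← rootPhase_sq]
  generalize Φ.rootPhase ε x = s at *
  generalize Φ.column ε 0 x = z0 at *
  generalize Φ.column ε 1 x = z1 at *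
  generalize Φ.column (-ε) 0 x = w0 at *
  generalize Φ.column (-ε) 1 x = w1 at *
  generalize ε * Complex.I * Complex.I * sqrtTwo / 4 = κ at *
  generalize ε * Complex.I = e at *
  linear_combination
    ((3 / 4 * e * (s ^ 3 * z0 + κ * ((Φ.u x : ℂ) * (s * w0))) - s * w1) ^ 2
      + (3 / 4 * e * (s ^ 3 * z1 + κ * ((Φ.u x : ℂ) * (s * w1))) + s * w0) ^ 2) * Complex.I_sq
    + 3 * e * s ^ 4 * h - 6 * s ^ 4 * hj

end LocalParam

namespace LocalParam

variable {Φ : LocalParam} {x : Pt} {ε : ℂ}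

/-! ### Curvature of the metric and of its rescaling -/

theorem contDiffOn_scale (α : ℂ) : ContDiffOn ℝ ∞ (fun x => (α * Φ.phase ε x) ^ 2) Φ.dom :=
  (contDiffOn_const.mul contDiffOn_phase).pow 2

theorem scale_ne_zero {α : ℂ} (hα : α ≠ 0) : (α * Φ.phase ε x) ^ 2 ≠ 0 :=
  pow_ne_zero _ (mul_ne_zero hα phase_ne_zero)

/-- The conformal factor is the constant α², so its logarithmic gradient ψ and the derivative H of ψ
are zero. -/
theorem conformalCoords_scale (hε : ε = 1 ∨ ε = -1) {α : ℂ} (hα : α ≠ 0) :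
    ConformalCoords Φ.dom (rescale (fun x => (α * Φ.phase ε x) ^ 2) (Φ.gTilde ε))
      (Φ.flatCoords ε) 0 (fun _ => α ^ 2) 0 where
  isOpen := Φ.isOpen_dom
  isMetric := isMetricOn_rescale (isMetricOn_gTilde hε) (contDiffOn_scale α)
    fun _ _ => scale_ne_zero hα
  smooth_y := smooth_flatCoords
  smooth_ψ := smoothForm_zero
  smooth_f := contDiffOn_const
  g_eq x hx i j := by
    rw [← phase_sq_mul_gTilde hε hx]
    simp only [rescale, Matrix.smul_apply, smul_eq_mul]
    ring
  pd_f x _ i := by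
    rw [pd_const]
    simp
  pd_ψ x _ i := by
    funext a
    have : pdVec i (0 : Pt → Fin 5 → ℂ) x a = 0 := pd_const 0 i
    simp [this]
  symm _ _ := Matrix.isSymm_zero

/-- The metric `e^{± 2 i r / 3} g̃` and its constant multiples are flat. -/
theorem riemann_scale (hε : ε = 1 ∨ ε = -1) {α : ℂ} (hα : α ≠ 0) (hx : x ∈ Φ.dom)
    (l k i j : Fin 5) :
    riemann (rescale (fun x => (α * Φ.phase ε x) ^ 2) (Φ.gTilde ε)) l k i j x = 0 :=
  (conformalCoords_scale hε hα).riemann_eq_zero hx l k i j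

/-- The coordinates `y` without the last one. -/
def truncatedCoords (Φ : LocalParam) (ε : ℂ) (x : Pt) : Fin 5 → ℂ :=
  ![1, 1, 1, 1, 0] * Φ.flatCoords ε x

theorem smooth_truncatedCoords : SmoothForm Φ.dom (Φ.truncatedCoords ε) := fun a =>
  contDiffOn_const.mul (smooth_flatCoords a)

theorem pdVec_truncatedCoords (hx : x ∈ Φ.dom) (i : Fin 5) :
    pdVec i (Φ.truncatedCoords ε) x = ![1, 1, 1, 1, 0] * pdVec i (Φ.flatCoords ε) x :=
  funext fun a => pd_const_mul _
    (smooth_differentiableAt Φ.isOpen_dom (smooth_flatCoords a) hx) i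

/-- Half the differential of `flatCoords_sq`. -/
theorem truncatedCoords_dotProduct_pdVec (hε : ε = 1 ∨ ε = -1) (hx : x ∈ Φ.dom) (i : Fin 5) :
    Φ.truncatedCoords ε x ⬝ᵥ pdVec i (Φ.flatCoords ε) x =
      2 * (ε * Complex.I) * Φ.phase ε x ^ 2 * Φ.dr x i := by
  have hy := fun a => smooth_differentiableAt Φ.isOpen_dom (smooth_truncatedCoords (ε := ε) a) hx
  have hp := smooth_differentiableAt Φ.isOpen_dom (contDiffOn_phase (ε := ε)) hx
  have h : pd i (fun z => Φ.truncatedCoords ε z ⬝ᵥ Φ.truncatedCoords ε z) x =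
      pd i (fun z => 6 * (Φ.phase ε z * Φ.phase ε z)) x := by
    refine pd_congr Φ.isOpen_dom hx (fun z _ => ?_) i
    have h1 := flatCoords_sq (Φ := Φ) hε z
    simp [truncatedCoords, dotProduct, Fin.sum_univ_five]
    linear_combination h1
  rw [pd_dotProduct hy hy, pd_const_mul _ (hp.fun_mul hp), pd_mul hp hp, pd_phase hx,
    pdVec_truncatedCoords hx] at h
  simp only [truncatedCoords, dotProduct, Fin.sum_univ_five, Pi.mul_apply, Matrix.cons_val] at h ⊢
  linear_combination (1 / 2) * h

/-- The matrix of second derivatives that belongs to the conformal factor `e^{∓ 2 i r / 3}`. -/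
def scaleHessian (Φ : LocalParam) (ε : ℂ) : BilinField := fun x =>
  (-(1 / 6) * Φ.phase (-ε) x ^ 2) • Matrix.diagonal ![1, 1, 1, 1, 0]
    + ((1 / 18) * Φ.phase (-ε) x ^ 4) •
      Matrix.vecMulVec (Φ.truncatedCoords ε x) (Φ.truncatedCoords ε x)

theorem contDiffOn_psi_coeff :
    ContDiffOn ℝ ∞ (fun x => -(1 / 6) * (Φ.phase (-ε) x * Φ.phase (-ε) x)) Φ.dom :=
  contDiffOn_const.mul (contDiffOn_phase.mul contDiffOn_phase)

/-- With ŷ the truncated coordinates, f = e^{∓2ir/3} = 6/(ŷ·ŷ). Then ψ, half the logarithmic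
gradient of f in y, is -ŷ/(ŷ·ŷ) = -(f/6) ŷ, and differentiating once more gives H = -(f/6)
diag(1,1,1,1,0) + (f²/18) ŷŷᵀ. -/
theorem conformalCoords_gTilde (hε : ε = 1 ∨ ε = -1) :
    ConformalCoords Φ.dom (Φ.gTilde ε) (Φ.flatCoords ε)
      (fun x => (-(1 / 6) * (Φ.phase (-ε) x * Φ.phase (-ε) x)) • Φ.truncatedCoords ε x)
      (fun x => Φ.phase (-ε) x * Φ.phase (-ε) x) (Φ.scaleHessian ε) where
  isOpen := Φ.isOpen_dom
  isMetric := isMetricOn_gTilde hε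
  smooth_y := smooth_flatCoords
  smooth_ψ := SmoothForm.smul contDiffOn_psi_coeff smooth_truncatedCoords
  smooth_f := contDiffOn_phase.mul contDiffOn_phase
  g_eq x hx i j := by
    have h := phase_neg_mul (Φ := Φ) (ε := ε) (x := x)
    rw [← phase_sq_mul_gTilde hε hx]
    linear_combination -(Φ.gTilde ε x i j) * (Φ.phase (-ε) x * Φ.phase ε x + 1) * h
  pd_f x hx i := by
    have h := phase_neg_mul (Φ := Φ) (ε := ε) (x := x)
    have hp := smooth_differentiableAt Φ.isOpen_dom (contDiffOn_phase (ε := -ε)) hx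
    rw [pd_mul hp hp, pd_phase hx, smul_dotProduct, truncatedCoords_dotProduct_pdVec hε hx,
      smul_eq_mul]
    linear_combination (2 / 3) * Φ.phase (-ε) x ^ 2 * (ε * Complex.I) * Φ.dr x i
      * (Φ.phase (-ε) x * Φ.phase ε x + 1) * h
  pd_ψ x hx i := by
    have h := phase_neg_mul (Φ := Φ) (ε := ε) (x := x)
    have hp := smooth_differentiableAt Φ.isOpen_dom (contDiffOn_phase (ε := -ε)) hx
    have hy := fun a => smooth_differentiableAt Φ.isOpen_dom
      (smooth_truncatedCoords (ε := ε) a) hx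
    rw [pdVec_smul (smooth_differentiableAt Φ.isOpen_dom contDiffOn_psi_coeff hx) hy,
      pd_const_mul _ (hp.fun_mul hp), pd_mul hp hp, pd_phase hx, pdVec_truncatedCoords hx,
      scaleHessian, Matrix.add_mulVec, Matrix.smul_mulVec, Matrix.smul_mulVec,
      Matrix.vecMulVec_mulVec, truncatedCoords_dotProduct_pdVec hε hx]
    funext a
    simp only [Pi.add_apply, Pi.smul_apply, Matrix.mulVec_diagonal, Pi.mul_apply, smul_eq_mul,
      MulOpposite.smul_eq_mul_unop, MulOpposite.unop_op]
    linear_combination -(1 / 9) * Φ.phase (-ε) x ^ 2 * (ε * Complex.I) * Φ.dr x i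
      * Φ.truncatedCoords ε x a * (Φ.phase (-ε) x * Φ.phase ε x + 1) * h
  symm x _ := Matrix.IsSymm.ext fun i j => by
    simp only [scaleHessian, Matrix.add_apply, Matrix.smul_apply, Matrix.vecMulVec_apply,
      smul_eq_mul, mul_comm (Φ.truncatedCoords ε x j)]
    congr 2
    by_cases hij : i = j
    · rw [hij]
    · rw [Matrix.diagonal_apply_ne _ hij, Matrix.diagonal_apply_ne _ (Ne.symm hij)]

end LocalParam

end NurowskiSU2

end

theorem mainTheorem5 (ε : ℂ) (hε : ε = 1 ∨ ε = -1) (α : ℂ) (hα : α ≠ 0)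
    (Φ : NurowskiSU2.LocalParam) :
    -- the Pfaffian systems span the annihilators of the two distributions
    (∀ x ∈ Φ.dom, NurowskiSU2.annihilator (Φ.distr ε x) =
      Submodule.span ℂ {Φ.omega1 ε x, Φ.omega2 x, Φ.omega3 ε x}) ∧
    (∀ x ∈ Φ.dom, NurowskiSU2.annihilator (Φ.distrTilde ε x) =
      Submodule.span ℂ {Φ.omegaBar1 ε x, Φ.omegaBar2 x, Φ.omegaBar3 ε x}) ∧
    -- the metric represents Nurowski's conformal class
    NurowskiSU2.IsMetricOn Φ.dom (Φ.gTilde ε) ∧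
    NurowskiSU2.RepresentsNurowskiClass Φ.dom (Φ.distr ε) (Φ.gTilde ε) ∧
    -- it has vanishing Weyl tensor and is conformally flat
    (∀ x ∈ Φ.dom, ∀ l k i j, NurowskiSU2.weyl (Φ.gTilde ε) l k i j x = 0) ∧
    NurowskiSU2.IsConformallyFlatOn Φ.dom (Φ.gTilde ε) ∧
    -- rescaling by the square of the phase factor gives a Ricci-flat representative
    NurowskiSU2.RepresentsNurowskiClass Φ.dom (Φ.distr ε)
      (NurowskiSU2.rescale (fun x => (α * Φ.phase ε x) ^ 2) (Φ.gTilde ε)) ∧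
    (∀ x ∈ Φ.dom, ∀ k j, NurowskiSU2.ricci
      (NurowskiSU2.rescale (fun x => (α * Φ.phase ε x) ^ 2) (Φ.gTilde ε)) k j x = 0) := by
  have hr := fun (x : NurowskiSU2.Pt) (hx : x ∈ Φ.dom) l k i j =>
    NurowskiSU2.LocalParam.riemann_scale hε hα hx l k i j
  have hg : NurowskiSU2.rescale (fun _ => 1) (Φ.gTilde ε) = Φ.gTilde ε :=
    funext fun x => one_smul ℂ _
  refine ⟨fun x hx => NurowskiSU2.LocalParam.annihilator_distr hx,
    fun x hx => NurowskiSU2.LocalParam.annihilator_distrTilde hx,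
    NurowskiSU2.LocalParam.isMetricOn_gTilde hε, ?_,
    fun x hx => (NurowskiSU2.LocalParam.conformalCoords_gTilde hε).weyl_eq_zero hx, ?_,
    NurowskiSU2.LocalParam.representsNurowskiClass_rescale hε
      (NurowskiSU2.LocalParam.contDiffOn_scale α)
      fun x _ => NurowskiSU2.LocalParam.scale_ne_zero hα,
    fun x hx k j => Finset.sum_eq_zero fun i _ => hr x hx i k i j⟩
  · rw [← hg]
    exact NurowskiSU2.LocalParam.representsNurowskiClass_rescale hε contDiffOn_const
      fun _ _ => one_ne_zero
  -- The square of the phase factor serves as flattening factor on the whole domain.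
  · exact fun x hx => ⟨Φ.dom, Φ.isOpen_dom, hx, subset_rfl, _,
      NurowskiSU2.LocalParam.contDiffOn_scale α,
      fun y _ => NurowskiSU2.LocalParam.scale_ne_zero hα, hr⟩
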